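/- Let $k$ be an algebraically closed field of characteristic zero and let $m>n\ge 0$ be integers with $m+n\ge 2$. Let $S_{m,n}\subset\mathbb{P}^{m+n+1}$ be the rational normal scroll, i.e. the Zariski closure of the image of $(s,t)\mapsto(1:s:\cdots:s^m:t:st:\cdots:s^nt)$. Its ruling is the family of lines which join the points $(a^m:a^{m-1}b:\cdots:b^m:0:\cdots:0)$ and $(0:\cdots:0:a^n:a^{n-1}b:\cdots:b^n)$, $(a:b)\in\mathbb{P}^1$; these are the closures of the fibres $s=\text{const}$ together with the line at $s=\infty$. Let $X=g(S_{m,n})$ for a projective isomorphism $g$ of $\mathbb{P}^{m+n+1}$; the ruling of $X$ is the image under $g$ of the ruling of $S_{m,n}$. Let $L(X)\subset\mathfrak{sl}_{m+n+2}$ be the Lie algebra of $X$, i.e. the tangent space at the identity of the group $\mathrm{PGL}(X)$ of all projective transformations that map $X$ onto itself. Let $\mathrm{LSA}(X)$ be a Levi subalgebra of $L(X)$ (a semisimple subalgebra which is a vector space complement of the solvable radical), let $\sigma:\mathfrak{sl}_2\to \mathrm{LSA}(X)$ be an isomorphism of Lie algebras, and let $h=\begin{pmatrix}1&0\\0&-1\end{pmatrix}$,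 $y=\begin{pmatrix}0&0\\1&0\end{pmatrix}$. Let $\mathrm{Rep}$ be the induced representation of $\mathfrak{sl}_2$ on the space $k^{m+n+2}$ of linear forms on $\mathbb{P}^{m+n+1}$, $\mathrm{Rep}(\xi)\ell=-\ell\circ\sigma(\xi)$. Let $v$ be an eigenvector of $\mathrm{Rep}(h)$ for its largest (integer) eigenvalue, and let $w=\mathrm{Rep}(y)\cdot v$. Then the linear form $v$ does not vanish identically on $X$, and $w/v$ defines a rational map $X\dashrightarrow\mathbb{P}^1$ with well-defined values $(w:v)$ wherever it is regular. If $n\ge1$, it is regular on all of $X$, and its fibres over the points of $\mathbb{P}^1$ are exactly the lines of the ruling of $X$. If $n=0$, so that $X$ is a cone over a rational normal curve, it is regular exactly at the points of $X$ other than the vertex, and its fibres are exactly the lines of the ruling of $X$ with the vertex removed. -/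

import Mathlib

open scoped LinearAlgebra.Projectivization Matrix Pointwise

noncomputable section

attribute [local instance 100] LieRing.ofAssociativeRing

namespace ScrollFib

section ProjectiveGeometry

variable {k : Type*} [Field k] {ι : Type*}

/-- A form `F` vanishes at the point `p` of projective space. (The representative of `p` does not
matter if `F` is homogeneous, which is the only case in which this is used.) -/
def FormVanishesAt (F : MvPolynomial ι k) (p : ℙ k (ι → k)) : Prop :=
  MvPolynomial.eval p.rep F = 0

/-- The Zariski closure of a set of points of projective space: the common zeros of all the
homogeneous polynomials that vanish on the set. -/
def zariskiClosure (A : Set (ℙ k (ι → k))) : Set (ℙ k (ι → k)) :=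
  {p | ∀ (d : ℕ) (F : MvPolynomial ι k), F.IsHomogeneous d →
    (∀ q ∈ A, FormVanishesAt F q) → FormVanishesAt F p}

/-- The linear form `∑ vᵢ xᵢ` with coefficient vector `v`. -/
def linForm [Fintype ι] (v : ι → k) : MvPolynomial ι k :=
  ∑ i, MvPolynomial.C (v i) * MvPolynomial.X i

/-- `RatMapsTo X F G p q`: the rational map `F / G : X ⇢ ℙ¹`, `x ↦ (F(x) : G(x))`, given by two
forms `F, G` of the same degree is regular at the point `p` and takes the value `q` there. This
means that some representation of the same rational map on `X` as a quotient `F' / G'` of forms of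
equal degree (that is, `F' G - G' F` is zero on `X`) has `F'(p), G'(p)` not both zero and
`q = (F'(p) : G'(p))`. The affine value `c` is the point `(c : 1)`, and `∞` is `(1 : 0)`. -/
def RatMapsTo (X : Set (ℙ k (ι → k))) (F G : MvPolynomial ι k)
    (p : ℙ k (ι → k)) (q : ℙ k (Fin 2 → k)) : Prop :=
  ∃ (d : ℕ) (F' G' : MvPolynomial ι k), F'.IsHomogeneous d ∧ G'.IsHomogeneous d ∧
    (∀ x ∈ X, FormVanishesAt (F' * G - G' * F) x) ∧
    ∃ h : (![MvPolynomial.eval p.rep F', MvPolynomial.eval p.rep G'] : Fin 2 → k) ≠ 0,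
      q = Projectivization.mk k _ h

/-- The fibre over `q ∈ ℙ¹` of the rational map `F / G : X ⇢ ℙ¹` on its domain of regularity. -/
def ratFibre (X : Set (ℙ k (ι → k))) (F G : MvPolynomial ι k) (q : ℙ k (Fin 2 → k)) :
    Set (ℙ k (ι → k)) :=
  {p ∈ X | RatMapsTo X F G p q}

end ProjectiveGeometry

section Scroll

variable (k : Type*) [Field k] (m n : ℕ)

/-- The homogeneous coordinates `x₀₀, …, x₀ₘ, x₁₀, …, x₁ₙ` of `ℙ^(m+n+1)`. -/
abbrev Idx (m n : ℕ) : Type := Fin (m + 1) ⊕ Fin (n + 1)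

/-- The vector `(1, s, s², …, sᵐ, t, st, s²t, …, sⁿt)`. -/
def scrollVec (s t : k) : Idx m n → k :=
  Sum.elim (fun i => s ^ (i : ℕ)) (fun j => s ^ (j : ℕ) * t)

/-- The scroll `S_{m,n}`: the Zariski closure of the image of
`(s, t) ↦ (1 : s : ⋯ : sᵐ : t : st : ⋯ : sⁿt)`. -/
def scroll : Set (ℙ k (Idx m n → k)) :=
  zariskiClosure {p | ∃ (s t : k) (h : scrollVec k m n s t ≠ 0),
    p = Projectivization.mk k (scrollVec k m n s t) h}

/-- The line of the ruling of `S_{m,n}` over `(a : b)`: it joins the points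
`(aᵐ : aᵐ⁻¹b : ⋯ : bᵐ : 0 : ⋯ : 0)` and `(0 : ⋯ : 0 : aⁿ : aⁿ⁻¹b : ⋯ : bⁿ)`. For `(a : b) = (1 : s)`
it is the closure of the fibre `s = constant`; `(0 : 1)` gives the line at `s = ∞`. -/
def rulingLine (a b : k) : Set (ℙ k (Idx m n → k)) :=
  {p | p.submodule ≤ Submodule.span k
    {Sum.elim (fun i : Fin (m + 1) => a ^ (m - (i : ℕ)) * b ^ (i : ℕ)) (fun _ => 0),
     Sum.elim (fun _ => 0) (fun j : Fin (n + 1) => a ^ (n - (j : ℕ)) * b ^ (j : ℕ))}}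

/-- The ruling of `S_{m,n}`, as a set of lines. -/
def ruling : Set (Set (ℙ k (Idx m n → k))) :=
  {L | ∃ a b : k, (a ≠ 0 ∨ b ≠ 0) ∧ L = rulingLine k m n a b}

/-- The vertex `(0 : ⋯ : 0 : 1)` of the cone `S_{m,0}`; the empty set if `n ≠ 0`. -/
def coneVertex : Set (ℙ k (Idx m n → k)) :=
  {p | n = 0 ∧ ∀ i : Fin (m + 1), p.rep (Sum.inl i) = 0}

end Scroll

section LieAlgebraOfVariety

variable {k : Type*} [Field k] {ι : Type*} [Fintype ι] [DecidableEq ι]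

set_option linter.unusedSectionVars false

/-- The group of all linear automorphisms of `k^ι` whose projective transformation maps `X` onto
itself, i.e. the preimage in `GL` of the group `PGL(X)`. -/
def stab (X : Set (ℙ k (ι → k))) : Subgroup ((ι → k) ≃ₗ[k] (ι → k)) :=
  MulAction.stabilizer ((ι → k) ≃ₗ[k] (ι → k)) X

/-- The value of a polynomial function in the matrix entries at a square matrix. -/
def evalMat (A : Matrix ι ι k) : MvPolynomial (ι × ι) k →ₐ[k] k :=
  MvPolynomial.aeval (fun e => A e.1 e.2)

/-- `F` vanishes on the group of linear automorphisms preserving `X`. -/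
def VanishesOnStab (X : Set (ℙ k (ι → k))) (F : MvPolynomial (ι × ι) k) : Prop :=
  ∀ g ∈ stab X, evalMat (LinearMap.toMatrix' (g : (ι → k) →ₗ[k] (ι → k))) F = 0

/-- The differential at the identity matrix of a polynomial function `F`, in the direction `M`. -/
def diffAtOne (F : MvPolynomial (ι × ι) k) (M : Matrix ι ι k) : k :=
  ∑ e : ι × ι, M e.1 e.2 * evalMat (1 : Matrix ι ι k) (MvPolynomial.pderiv e F)

/-- Auxiliary: the left invariant vector field on matrices with value `M` at the identity. -/
def invDer (M : Matrix ι ι k) :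
    Derivation k (MvPolynomial (ι × ι) k) (MvPolynomial (ι × ι) k) :=
  MvPolynomial.mkDerivation k
    (fun e => ∑ l, MvPolynomial.X (e.1, l) * MvPolynomial.C (M l e.2))

/-- Auxiliary: the substitution `F ↦ F(A · )`. -/
def leftSubst (A : Matrix ι ι k) : MvPolynomial (ι × ι) k →ₐ[k] MvPolynomial (ι × ι) k :=
  MvPolynomial.aeval (fun e => ∑ l, MvPolynomial.C (A e.1 l) * MvPolynomial.X (l, e.2))

theorem evalMat_leftSubst (A B : Matrix ι ι k) (F : MvPolynomial (ι × ι) k) :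
    evalMat B (leftSubst A F) = evalMat (A * B) F := by
  have : (evalMat B).comp (leftSubst A) = evalMat (A * B) := by
    ext e
    simp [evalMat, leftSubst, Matrix.mul_apply]
  exact congrArg (fun f => f F) this

theorem diffAtOne_eq (F : MvPolynomial (ι × ι) k) (M : Matrix ι ι k) :
    diffAtOne F M = evalMat 1 (invDer M F) := by
  induction F using MvPolynomial.induction_on with
  | C a => simp [diffAtOne, invDer]
  | add p q hp hq =>
    simp only [diffAtOne, map_add, mul_add, Finset.sum_add_distrib] at *
    rw [hp, hq]
  | mul_X p e hp =>
    simp only [diffAtOne, Derivation.leibniz, map_add, smul_eq_mul, map_mul, mul_add,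
      Finset.sum_add_distrib] at *
    rw [← hp]
    congr 1
    · rw [Finset.sum_eq_single e]
      · simp [invDer, evalMat, Matrix.one_apply, MvPolynomial.mkDerivation_X]
        ring
      · intro b _ hb
        simp [MvPolynomial.pderiv_X_of_ne (Ne.symm hb)]
      · simp
    · rw [Finset.mul_sum]
      refine Finset.sum_congr rfl fun x _ => by ring

theorem invDer_leftSubst (A M : Matrix ι ι k) (F : MvPolynomial (ι × ι) k) :
    invDer M (leftSubst A F) = leftSubst A (invDer M F) := by
  induction F using MvPolynomial.induction_on with
  | C a => simp [leftSubst, invDer]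
  | add p q hp hq => simp only [map_add, hp, hq]
  | mul_X p e hp =>
    simp only [map_mul, Derivation.leibniz, smul_eq_mul, map_add, hp]
    congr 2
    simp only [leftSubst, invDer, MvPolynomial.aeval_X, map_sum, Derivation.leibniz,
      MvPolynomial.mkDerivation_X, MvPolynomial.derivation_C, smul_eq_mul, mul_zero, add_zero,
      map_mul, MvPolynomial.aeval_C, MvPolynomial.algebraMap_eq, Finset.mul_sum, Finset.sum_mul]
    rw [Finset.sum_comm]
    refine Finset.sum_congr rfl fun x _ => Finset.sum_congr rfl fun y _ => by ring

theorem vanishesOnStab_invDer {X : Set (ℙ k (ι → k))} {M : Matrix ι ι k}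
    (hM : ∀ F, VanishesOnStab X F → diffAtOne F M = 0) {F : MvPolynomial (ι × ι) k}
    (hF : VanishesOnStab X F) : VanishesOnStab X (invDer M F) := by
  intro g hg
  have h1 := hM (leftSubst (LinearMap.toMatrix' (g : (ι → k) →ₗ[k] (ι → k))) F) (by
    intro g' hg'
    rw [evalMat_leftSubst, ← LinearMap.toMatrix'_mul]
    exact hF (g * g') (mul_mem hg hg'))
  rw [diffAtOne_eq, invDer_leftSubst, evalMat_leftSubst, mul_one] at h1
  exact h1

theorem invDer_X (M : Matrix ι ι k) (e : ι × ι) :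
    invDer M (MvPolynomial.X e) =
      ∑ l, MvPolynomial.X (e.1, l) * MvPolynomial.C (M l e.2) :=
  MvPolynomial.mkDerivation_X _ _ _

theorem invDer_invDer_X (M N : Matrix ι ι k) (e : ι × ι) :
    invDer M (invDer N (MvPolynomial.X e)) =
      ∑ l, MvPolynomial.X (e.1, l) * MvPolynomial.C ((M * N) l e.2) := by
  have h : ∀ l, invDer M (MvPolynomial.X (e.1, l) * MvPolynomial.C (N l e.2)) =
      ∑ j, MvPolynomial.X (e.1, j) * (MvPolynomial.C (M j l) * MvPolynomial.C (N l e.2)) := by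
    intro l
    rw [Derivation.leibniz, invDer_X, ← MvPolynomial.algebraMap_eq, Derivation.map_algebraMap,
      smul_zero, zero_add, smul_eq_mul, Finset.mul_sum]
    exact Finset.sum_congr rfl fun j _ => by ring
  rw [invDer_X, map_sum, Finset.sum_congr rfl (fun l _ => h l), Finset.sum_comm]
  refine Finset.sum_congr rfl fun j _ => ?_
  rw [Matrix.mul_apply, map_sum, Finset.mul_sum]
  exact Finset.sum_congr rfl fun l _ => by rw [map_mul]

theorem invDer_lie (M N : Matrix ι ι k) (F : MvPolynomial (ι × ι) k) :
    invDer ⁅M, N⁆ F = invDer M (invDer N F) - invDer N (invDer M F) := by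
  rw [← Derivation.commutator_apply]
  refine MvPolynomial.derivation_eq_of_forall_mem_vars fun e _ => ?_
  rw [Derivation.commutator_apply, invDer_invDer_X, invDer_invDer_X, invDer_X,
    ← Finset.sum_sub_distrib]
  refine Finset.sum_congr rfl fun j _ => ?_
  rw [LieRing.of_associative_ring_bracket, Matrix.sub_apply, map_sub, mul_sub]

/-- The tangent space at the identity of the algebraic group of all invertible matrices whose
projective transformation maps `X` onto itself: the matrices on which the differentials at the
identity of all polynomial functions vanishing on that group are zero. -/
def glLie (X : Set (ℙ k (ι → k))) : LieSubalgebra k (Matrix ι ι k) where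
  carrier := {M | ∀ F : MvPolynomial (ι × ι) k, VanishesOnStab X F → diffAtOne F M = 0}
  add_mem' := by
    intro M N hM hN F hF
    have h1 := hM F hF
    have h2 := hN F hF
    simp only [diffAtOne, Matrix.add_apply, add_mul, Finset.sum_add_distrib] at *
    rw [h1, h2, add_zero]
  zero_mem' := by
    intro F _
    simp [diffAtOne]
  smul_mem' := by
    intro c M hM F hF
    have h1 := hM F hF
    simp only [diffAtOne, Matrix.smul_apply, smul_eq_mul, mul_assoc, ← Finset.mul_sum] at *
    rw [h1, mul_zero]
  lie_mem' := by
    intro M N hM hN F hF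
    rw [diffAtOne_eq, invDer_lie, map_sub, ← diffAtOne_eq, ← diffAtOne_eq,
      hM _ (vanishesOnStab_invDer hN hF), hN _ (vanishesOnStab_invDer hM hF), sub_zero]

/-- The Lie algebra `L(X)` of a projective variety `X` (in characteristic zero): the tangent space
at the identity of `PGL(X)`, realised as usual inside the trace zero matrices, which are the tangent
space `𝔤𝔩 / scalars` of `PGL`. -/
def lieAlg (X : Set (ℙ k (ι → k))) : LieSubalgebra k (Matrix ι ι k) :=
  glLie X ⊓ LieAlgebra.SpecialLinear.sl ι k

end LieAlgebraOfVariety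

section Representation

variable {k : Type*} [Field k]

/-- `S` is a Levi subalgebra of the Lie algebra `L`: it is semisimple and `L` is, as a vector space,
the direct sum of `S` and the solvable radical (so that `L` is the semidirect sum of the two). -/
structure IsLevi {L : Type*} [LieRing L] [LieAlgebra k L]
    (S : LieSubalgebra k L) : Prop where
  semisimple : LieAlgebra.IsSemisimple k S
  isCompl : IsCompl S.toSubmodule (LieAlgebra.radical k L).toSubmodule

/-- The Lie algebra `𝔰𝔩₂`. -/
abbrev sl2 (k : Type*) [Field k] : LieSubalgebra k (Matrix (Fin 2) (Fin 2) k) :=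
  LieAlgebra.SpecialLinear.sl (Fin 2) k

/-- The Chevalley basis element `h`. -/
def sl2H (k : Type*) [Field k] : sl2 k :=
  ⟨!![1, 0; 0, -1], LinearMap.mem_ker.2 (by simp [Matrix.trace_fin_two])⟩

/-- The Chevalley basis element `y`. -/
def sl2Y (k : Type*) [Field k] : sl2 k :=
  ⟨!![0, 0; 1, 0], LinearMap.mem_ker.2 (by simp [Matrix.trace_fin_two])⟩

variable {ι : Type*} [Fintype ι] [DecidableEq ι]

/-- The action of matrices on the coefficient vectors of linear forms: the endomorphism `M` of `k^ι`
sends the form `ℓ` to `-ℓ ∘ M`, so that coefficient vectors are multiplied by `-Mᵀ`. -/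
def onForms : Matrix ι ι k →ₗ⁅k⁆ Matrix ι ι k where
  toFun M := -Mᵀ
  map_add' M N := by rw [Matrix.transpose_add, neg_add]
  map_smul' c M := by simp
  map_lie' := by
    intro M N
    simp [Ring.lie_def, Matrix.transpose_sub, Matrix.transpose_mul]

/-- The representation `Rep` of `𝔰𝔩₂` on the linear forms on `ℙ^N` (written as coefficient vectors
in `k^(N+1)`) induced by an identification of `𝔰𝔩₂` with a subalgebra `S` of `L(X)`. -/
def Rep {X : Set (ℙ k (ι → k))} {S : LieSubalgebra k (lieAlg X)} (σ : sl2 k ≃ₗ⁅k⁆ S) :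
    sl2 k →ₗ⁅k⁆ Matrix ι ι k :=
  onForms.comp ((lieAlg X).incl.comp (S.incl.comp (σ : sl2 k →ₗ⁅k⁆ S)))

end Representation

end ScrollFib

end

/-!
A point of `S_{m,n}` has the form `(l aᵐ⁻ⁱ bⁱ ; u aⁿ⁻ʲ bʲ)`, and `(a : b)` is the point of the
projective line under its line of the ruling (`mk_mem_scroll`, `mk_mem_rulingLine`). A linear form
on the ambient space is a pair of polynomials of degrees at most `m` and `n` in the affine
coordinate `s = b / a`, one for each block of coordinates.

A matrix in the Lie algebra of `X` annihilates the differentials of the `2 × 2` minors that vanish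
on `X`. Written out on the parametrized scroll, this is a recursion between the rows of the
matrix. Because `n < m`, it shows that the forms in the first block are preserved, that the matrix
acts on them by a vector field `-d ∂/∂s` of the projective line, with `d` of degree at most two,
on sections of `𝒪(m)`, and that it acts on the quotient by the same vector field on sections of
`𝒪(n)`, in both cases up to scalars (`exists_vectorField_of_mem_glLie`).

The image of `𝔰𝔩₂` therefore gives a triple of vector fields `E, H, F`. The scalars vanish, being
those of commutators, and the triple is not zero, as otherwise `h` would act by zero. The relation
`[H, E] = 2E` forces `E = ℓ²` and `H = ℓ ℓ'` with independent linear forms `ℓ, ℓ'` in `(a, b)`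
(`exists_factorization`). Then `ℓᵐ` has weight `m`, while a vector killed by `x` with nonzero
image in the quotient has weight `n < m`. So a vector `v` of largest weight lies in the first
block, is killed by `x`, and is `c ℓᵐ`, and `w = y v` is `-(m/2) c ℓᵐ⁻¹ ℓ'`
(`highestWeight_eq_pow`).

On `X` the rational map `w / v` is thus `-(m/2) ℓ' / ℓ`, the projection to the base of the ruling
followed by an automorphism of the projective line. Identities between forms hold as soon as they
hold on a dense set, so any representation `F' / G'` of it takes this value wherever it is defined
(`IsPowerPair.eq_value_of_ratMapsTo`). Away from the vertex `ℓ'` and `ℓ`, multiplied by a suitable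
monomial, give a representation by linear forms (`IsPowerPair.ratMapsTo_value`), whereas the
vertex lies over all points of the base, so that no value is possible there.
-/

noncomputable section

attribute [local instance 100] LieRing.ofAssociativeRing

namespace ScrollFib

/-! ### Evaluation of forms and density -/

theorem eval_smul_of_isHomogeneous {k ι : Type*} [Field k] {F : MvPolynomial ι k} {d : ℕ}
    (hF : F.IsHomogeneous d) (c : k) (x : ι → k) :
    MvPolynomial.eval (c • x) F = c ^ d * MvPolynomial.eval x F := by
  rw [MvPolynomial.eval_eq, MvPolynomial.eval_eq, Finset.mul_sum]
  refine Finset.sum_congr rfl fun e he => ?_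
  have hd : ∑ i ∈ e.support, e i = d := by
    have := hF (MvPolynomial.mem_support_iff.1 he)
    simpa [Finsupp.weight_apply, Finsupp.sum] using this
  simp only [Pi.smul_apply, smul_eq_mul, mul_pow, Finset.prod_mul_distrib,
    Finset.prod_pow_eq_pow_sum, hd]
  ring

theorem formVanishesAt_mk {k ι : Type*} [Field k] {F : MvPolynomial ι k} {d : ℕ}
    (hF : F.IsHomogeneous d) (x : ι → k) (hx : x ≠ 0) :
    FormVanishesAt F (Projectivization.mk k x hx) ↔ MvPolynomial.eval x F = 0 := by
  obtain ⟨c, hc⟩ := Projectivization.exists_smul_eq_mk_rep k x hx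
  rw [FormVanishesAt, ← hc, Units.smul_def, eval_smul_of_isHomogeneous hF]
  simp

theorem eq_zero_of_eval_eq_zero_of_eval_ne_zero {k σ : Type*} [Field k] [Infinite k]
    {D R : MvPolynomial σ k} (hD : D ≠ 0)
    (h : ∀ z, MvPolynomial.eval z D ≠ 0 → MvPolynomial.eval z R = 0) : R = 0 := by
  have : D * R = 0 := by
    refine MvPolynomial.funext fun z => ?_
    rw [map_mul, map_zero, mul_eq_zero]
    exact or_iff_not_imp_left.2 (h z)
  exact (mul_eq_zero.1 this).resolve_left hD

/-! ### The points of the scroll -/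

section ScrollPoints

variable {k : Type*} [Field k] {m n : ℕ}

/-- The vector `(l aᵐ⁻ⁱ bⁱ ; u aⁿ⁻ʲ bʲ)`. For fixed `(a, b)` these vectors, with `l` and `u`
arbitrary, span the line of the ruling over `(a : b)`. -/
def rulingPoint (m n : ℕ) (a b l u : k) : Idx m n → k :=
  Sum.elim (fun i => l * (a ^ (m - (i : ℕ)) * b ^ (i : ℕ)))
    (fun j => u * (a ^ (n - (j : ℕ)) * b ^ (j : ℕ)))

/-- The coordinates of `rulingPoint m n a b l u` as polynomials in the variables
`a, b, l, u`, numbered from `0` to `3`. -/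
def rulingPoly (k : Type*) [Field k] (m n : ℕ) : Idx m n → MvPolynomial (Fin 4) k :=
  Sum.elim (fun i => .X 2 * (.X 0 ^ (m - (i : ℕ)) * .X 1 ^ (i : ℕ)))
    (fun j => .X 3 * (.X 0 ^ (n - (j : ℕ)) * .X 1 ^ (j : ℕ)))

theorem eval_aeval_rulingPoly (F : MvPolynomial (Idx m n) k) (z : Fin 4 → k) :
    MvPolynomial.eval z (MvPolynomial.aeval (rulingPoly k m n) F) =
      MvPolynomial.eval (rulingPoint m n (z 0) (z 1) (z 2) (z 3)) F := by
  have : ((MvPolynomial.aeval z).comp (MvPolynomial.aeval (rulingPoly k m n)) :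
      MvPolynomial (Idx m n) k →ₐ[k] k) =
      MvPolynomial.aeval (rulingPoint m n (z 0) (z 1) (z 2) (z 3)) := by
    ext i
    rcases i with i | j <;> simp [rulingPoly, rulingPoint]
  exact congrArg (fun f => f F) this

theorem rulingPoint_eq_smul_scrollVec {a l : k} (ha : a ≠ 0) (hl : l ≠ 0) (b u : k) :
    rulingPoint m n a b l u =
      (l * a ^ m) • scrollVec k m n (b / a) (u * a ^ n / (l * a ^ m)) := by
  funext i
  have hp : ∀ N i : ℕ, i ≤ N → a ^ (N - i) * b ^ i = a ^ N * (b / a) ^ i := by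
    intro N i hi
    rw [← Nat.sub_add_cancel hi, pow_add, Nat.sub_add_cancel hi, div_pow]
    field_simp
  rcases i with i | j
  · simp only [rulingPoint, scrollVec, Sum.elim_inl, Pi.smul_apply, smul_eq_mul,
      hp m i (Nat.lt_succ_iff.1 i.2), mul_assoc]
  · simp only [rulingPoint, scrollVec, Sum.elim_inr, Pi.smul_apply, smul_eq_mul,
      hp n j (Nat.lt_succ_iff.1 j.2)]
    have := pow_ne_zero m ha
    field_simp

theorem scrollVec_eq_rulingPoint (s t : k) : scrollVec k m n s t = rulingPoint m n 1 s 1 t := by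
  rw [rulingPoint_eq_smul_scrollVec one_ne_zero one_ne_zero]
  simp

theorem scrollVec_ne_zero (s t : k) : scrollVec k m n s t ≠ 0 := fun h => by
  have := congrFun h (Sum.inl 0)
  simp [scrollVec] at this

theorem eval_rulingPoint_eq_zero [Infinite k] {F : MvPolynomial (Idx m n) k} {d : ℕ}
    (hF : F.IsHomogeneous d) (h : ∀ s t, MvPolynomial.eval (scrollVec k m n s t) F = 0)
    (a b l u : k) : MvPolynomial.eval (rulingPoint m n a b l u) F = 0 := by
  have h0 : MvPolynomial.aeval (rulingPoly k m n) F = 0 := by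
    refine eq_zero_of_eval_eq_zero_of_eval_ne_zero (D := .X 0 * .X 2)
      (mul_ne_zero (MvPolynomial.X_ne_zero _) (MvPolynomial.X_ne_zero _)) fun z hz => ?_
    simp only [map_mul, MvPolynomial.eval_X] at hz
    rw [eval_aeval_rulingPoly, rulingPoint_eq_smul_scrollVec (left_ne_zero_of_mul hz)
      (right_ne_zero_of_mul hz), eval_smul_of_isHomogeneous hF, h, mul_zero]
  have := eval_aeval_rulingPoly F ![a, b, l, u]
  rw [h0, map_zero] at this
  exact this.symm

theorem eval_eq_zero_of_mem_scroll {F : MvPolynomial (Idx m n) k} {d : ℕ}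
    (hF : F.IsHomogeneous d) {x : Idx m n → k} {hx : x ≠ 0}
    (h : ∀ s t, MvPolynomial.eval (scrollVec k m n s t) F = 0)
    (hmem : Projectivization.mk k x hx ∈ scroll k m n) : MvPolynomial.eval x F = 0 := by
  rw [← formVanishesAt_mk hF x hx]
  refine hmem d F hF ?_
  rintro q ⟨s, t, h', rfl⟩
  rw [formVanishesAt_mk hF]
  exact h s t

/-- Upper row of the `2 × (m + n)` matrix whose minors cut out the scroll. -/
def loIdx : Fin m ⊕ Fin n → Idx m n := Sum.map Fin.castSucc Fin.castSucc

/-- Lower row of the `2 × (m + n)` matrix whose minors cut out the scroll. -/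
def hiIdx : Fin m ⊕ Fin n → Idx m n := Sum.map Fin.succ Fin.succ

theorem scrollVec_hiIdx (s t : k) (j : Fin m ⊕ Fin n) :
    scrollVec k m n s t (hiIdx j) = s * scrollVec k m n s t (loIdx j) := by
  rcases j with j | j <;> simp [scrollVec, hiIdx, loIdx, pow_succ] <;> ring

theorem minor_eq_zero {x : Idx m n → k} {hx : x ≠ 0}
    (hmem : Projectivization.mk k x hx ∈ scroll k m n) (i j : Fin m ⊕ Fin n) :
    x (loIdx i) * x (hiIdx j) = x (hiIdx i) * x (loIdx j) := by
  have hF : (MvPolynomial.X (R := k) (loIdx i) * MvPolynomial.X (hiIdx j) -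
      MvPolynomial.X (hiIdx i) * MvPolynomial.X (loIdx j) :
        MvPolynomial (Idx m n) k).IsHomogeneous 2 :=
    ((MvPolynomial.isHomogeneous_X _ _).mul (MvPolynomial.isHomogeneous_X _ _)).sub
      ((MvPolynomial.isHomogeneous_X _ _).mul (MvPolynomial.isHomogeneous_X _ _))
  have := eval_eq_zero_of_mem_scroll hF (fun s t => by
    simp only [map_sub, map_mul, MvPolynomial.eval_X, scrollVec_hiIdx]
    ring) hmem
  simpa [sub_eq_zero] using this

theorem exists_eq_mul_pow_mul_pow {a b : k} (hab : a ≠ 0 ∨ b ≠ 0) {N : ℕ} {x : Fin (N + 1) → k}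
    (h : ∀ i : Fin N, a * x i.succ = b * x i.castSucc) :
    ∃ l, ∀ i, x i = l * (a ^ (N - (i : ℕ)) * b ^ (i : ℕ)) := by
  by_cases ha : a = 0
  · subst ha
    have hb : b ≠ 0 := by simpa using hab
    refine ⟨x (Fin.last N) / b ^ N, fun i => ?_⟩
    induction i using Fin.lastCases with
    | last => simp [hb]
    | cast i =>
      have h1 : x i.castSucc = 0 := by simpa [hb] using (h i).symm
      have h2 : N - (i : ℕ) ≠ 0 := by have := i.2; omega
      simp [h1, h2]
  · refine ⟨x 0 / a ^ N, fun i => ?_⟩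
    induction i using Fin.induction with
    | zero => simp [ha]
    | succ i ih =>
      have h1 : x i.succ = b / a * x i.castSucc := by
        rw [div_mul_eq_mul_div, eq_div_iff ha, ← h i]
        ring
      have h2 : N - (i : ℕ) = N - (i + 1 : ℕ) + 1 := by have := i.2; omega
      rw [h1, ih, Fin.val_succ, Fin.val_castSucc, h2]
      field_simp
      ring

theorem mk_mem_scroll [Infinite k] {x : Idx m n → k} (hx : x ≠ 0) :
    Projectivization.mk k x hx ∈ scroll k m n ↔
      ∃ a b l u, (a ≠ 0 ∨ b ≠ 0) ∧ x = rulingPoint m n a b l u := by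
  constructor
  · intro hmem
    have hm := minor_eq_zero hmem
    obtain ⟨a, b, hab, h⟩ : ∃ a b : k, (a ≠ 0 ∨ b ≠ 0) ∧
        ∀ j : Fin m ⊕ Fin n, a * x (hiIdx j) = b * x (loIdx j) := by
      by_cases h0 : ∃ j : Fin m ⊕ Fin n, x (loIdx j) ≠ 0 ∨ x (hiIdx j) ≠ 0
      · obtain ⟨j, hj⟩ := h0
        exact ⟨_, _, hj, hm j⟩
      · push Not at h0
        exact ⟨1, 0, by simp, fun j => by simp [(h0 j).2]⟩
    obtain ⟨l, hl⟩ := exists_eq_mul_pow_mul_pow hab (x := fun i => x (Sum.inl i))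
      fun i => h (Sum.inl i)
    obtain ⟨u, hu⟩ := exists_eq_mul_pow_mul_pow hab (x := fun i => x (Sum.inr i))
      fun i => h (Sum.inr i)
    refine ⟨a, b, l, u, hab, funext fun i => ?_⟩
    rcases i with i | j
    exacts [hl i, hu j]
  · rintro ⟨a, b, l, u, -, rfl⟩ d F hF hA
    rw [formVanishesAt_mk hF]
    refine eval_rulingPoint_eq_zero hF (fun s t => ?_) a b l u
    rw [← formVanishesAt_mk hF _ (scrollVec_ne_zero s t)]
    exact hA _ ⟨s, t, _, rfl⟩

theorem mk_mem_rulingLine {x : Idx m n → k} (hx : x ≠ 0) {a b : k} :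
    Projectivization.mk k x hx ∈ rulingLine k m n a b ↔
      ∃ l u, x = rulingPoint m n a b l u := by
  rw [rulingLine, Set.mem_ofPred_eq, Projectivization.submodule_mk,
    Submodule.span_singleton_le_iff_mem, Submodule.mem_span_pair]
  refine exists₂_congr fun l u => ?_
  rw [eq_comm]
  refine Eq.congr rfl (funext fun i => ?_)
  rcases i with i | j <;> simp [rulingPoint]

theorem mk_mem_coneVertex {x : Idx m n → k} (hx : x ≠ 0) :
    Projectivization.mk k x hx ∈ coneVertex k m n ↔ n = 0 ∧ ∀ i : Fin (m + 1), x (.inl i) = 0 := by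
  obtain ⟨c, hc⟩ := Projectivization.exists_smul_eq_mk_rep k x hx
  rw [coneVertex, Set.mem_ofPred_eq, ← hc]
  simp [Units.smul_def]

theorem mem_smul_iff_mk {g : (Idx m n → k) ≃ₗ[k] (Idx m n → k)} {A : Set (ℙ k (Idx m n → k))}
    {x : Idx m n → k} (hx : x ≠ 0) :
    Projectivization.mk k (g x) ((map_ne_zero_iff g g.injective).2 hx) ∈ g • A ↔
      Projectivization.mk k x hx ∈ A := by
  have : Projectivization.mk k (g x) ((map_ne_zero_iff g g.injective).2 hx) =
      g • Projectivization.mk k x hx := (Projectivization.smul_mk g hx).symm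
  rw [this, Set.smul_mem_smul_set_iff]

theorem exists_rulingPoint_inl_ne_zero {a b l : k} (hab : a ≠ 0 ∨ b ≠ 0) (hl : l ≠ 0) (u : k) :
    ∃ i : Fin (m + 1), rulingPoint m n a b l u (.inl i) ≠ 0 := by
  rcases hab with h | h
  · exact ⟨0, by simp [rulingPoint, hl, h]⟩
  · exact ⟨Fin.last m, by simp [rulingPoint, hl, h]⟩

end ScrollPoints

/-! ### Infinitesimal automorphisms of the scroll -/

section Differential

variable {k : Type*} [Field k] {ι : Type*} [Fintype ι]

/-- The bilinear expression `A ↦ y ⬝ A z` as a polynomial function of the matrix `A`. -/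
def sandwich (y z : ι → k) : MvPolynomial (ι × ι) k :=
  ∑ i, ∑ j, MvPolynomial.C (y i * z j) * MvPolynomial.X (i, j)

theorem evalMat_sandwich (y z : ι → k) (A : Matrix ι ι k) :
    evalMat A (sandwich y z) = y ⬝ᵥ (A *ᵥ z) := by
  simp only [evalMat, sandwich, map_sum, map_mul, MvPolynomial.aeval_C, MvPolynomial.aeval_X,
    dotProduct, Matrix.mulVec, Finset.mul_sum, Algebra.algebraMap_self, RingHom.id_apply]
  exact Finset.sum_congr rfl fun i _ => Finset.sum_congr rfl fun j _ => by ring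

variable [DecidableEq ι]

theorem diffAtOne_mul (F G : MvPolynomial (ι × ι) k) (M : Matrix ι ι k) :
    diffAtOne (F * G) M =
      evalMat (1 : Matrix ι ι k) F * diffAtOne G M +
        evalMat (1 : Matrix ι ι k) G * diffAtOne F M := by
  simp only [diffAtOne_eq, Derivation.leibniz, smul_eq_mul, map_add, map_mul]

theorem diffAtOne_sub (F G : MvPolynomial (ι × ι) k) (M : Matrix ι ι k) :
    diffAtOne (F - G) M = diffAtOne F M - diffAtOne G M := by
  simp only [diffAtOne_eq, map_sub]

theorem diffAtOne_sandwich (y z : ι → k) (M : Matrix ι ι k) :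
    diffAtOne (sandwich y z) M = y ⬝ᵥ (M *ᵥ z) := by
  simp only [diffAtOne_eq, sandwich, map_sum, Derivation.leibniz, smul_eq_mul,
    MvPolynomial.derivation_C, mul_zero, add_zero, invDer_X, map_mul]
  simp only [evalMat, MvPolynomial.aeval_C, MvPolynomial.aeval_X, Matrix.one_apply,
    dotProduct, Matrix.mulVec, Finset.mul_sum, Algebra.algebraMap_self, RingHom.id_apply]
  refine Finset.sum_congr rfl fun i _ => Finset.sum_congr rfl fun j _ => ?_
  simp
  ring

end Differential

section InfinitesimalAutomorphisms

variable {k : Type*} [Field k] {m n : ℕ}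

/-- The tangency condition: the differentials of the minors cutting out the scroll vanish along
every infinitesimal automorphism. -/
theorem minor_diff_eq_zero [Infinite k] {g : (Idx m n → k) ≃ₗ[k] (Idx m n → k)}
    {M : Matrix (Idx m n) (Idx m n) k} (hM : M ∈ glLie (g • scroll k m n)) (s t : k)
    {f : Idx m n → k} (hf : f = g.symm (M *ᵥ g (scrollVec k m n s t))) (i j : Fin m ⊕ Fin n) :
    f (loIdx i) * scrollVec k m n s t (hiIdx j) + scrollVec k m n s t (loIdx i) * f (hiIdx j) =
      f (hiIdx i) * scrollVec k m n s t (loIdx j) +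
        scrollVec k m n s t (hiIdx i) * f (loIdx j) := by
  set x := scrollVec k m n s t with hx
  set G' := LinearMap.toMatrix' (g.symm : (Idx m n → k) →ₗ[k] (Idx m n → k)) with hG'
  have hrow : ∀ (A : Matrix (Idx m n) (Idx m n) k) (r : Idx m n),
      G' r ⬝ᵥ (A *ᵥ g x) = g.symm (A *ᵥ g x) r := by
    intro A r
    have := congrFun (LinearMap.toMatrix'_mulVec
      (g.symm : (Idx m n → k) →ₗ[k] (Idx m n → k)) (A *ᵥ g x)) r
    exact this
  -- The minor of `g⁻¹ A g x` is a polynomial function of `A` vanishing on the stabilizer.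
  have hvan : VanishesOnStab (g • scroll k m n)
      (sandwich (G' (loIdx i)) (g x) * sandwich (G' (hiIdx j)) (g x) -
        sandwich (G' (hiIdx i)) (g x) * sandwich (G' (loIdx j)) (g x)) := by
    intro γ hγ
    simp only [map_sub, map_mul, evalMat_sandwich, hrow]
    have hγx : LinearMap.toMatrix' (γ : (Idx m n → k) →ₗ[k] (Idx m n → k)) *ᵥ g x = γ (g x) :=
      LinearMap.toMatrix'_mulVec _ _
    rw [hγx]
    have hx0 : x ≠ 0 := scrollVec_ne_zero s t
    have hgx0 : g x ≠ 0 := (map_ne_zero_iff g g.injective).2 hx0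
    have hy0 : g.symm (γ (g x)) ≠ 0 :=
      (map_ne_zero_iff _ g.symm.injective).2 ((map_ne_zero_iff _ γ.injective).2 hgx0)
    have hmem : Projectivization.mk k (g x) hgx0 ∈ g • scroll k m n := by
      rw [mem_smul_iff_mk hx0, mk_mem_scroll]
      exact ⟨1, s, 1, t, by simp, scrollVec_eq_rulingPoint s t⟩
    have hmem2 : Projectivization.mk k (g.symm (γ (g x))) hy0 ∈ scroll k m n := by
      rw [← mem_smul_iff_mk (g := g)]
      have h1 : γ • Projectivization.mk k (g x) hgx0 ∈ γ • (g • scroll k m n) :=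
        Set.smul_mem_smul_set hmem
      rw [MulAction.mem_stabilizer_iff.1 hγ, Projectivization.smul_mk] at h1
      simpa using h1
    exact sub_eq_zero.2 (minor_eq_zero hmem2 i j)
  have h0 := hM _ hvan
  have hrow1 : ∀ r, G' r ⬝ᵥ g x = x r := fun r => by simpa using hrow 1 r
  simp only [diffAtOne_sub, diffAtOne_mul, diffAtOne_sandwich, evalMat_sandwich, hrow, hrow1,
    Matrix.one_mulVec, ← hf] at h0
  linear_combination h0

/-- The polynomial `∑ vᵢ sⁱ` made of the coefficients in the first block of a linear form `v`. -/
def leftPoly : (Idx m n → k) →ₗ[k] Polynomial k where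
  toFun v := ∑ i, v (.inl i) • Polynomial.X ^ (i : ℕ)
  map_add' v w := by simp [add_smul, Finset.sum_add_distrib]
  map_smul' c v := by simp [mul_smul, Finset.smul_sum]

/-- The polynomial `∑ vⱼ sʲ` made of the coefficients in the second block of a linear form `v`. -/
def rightPoly : (Idx m n → k) →ₗ[k] Polynomial k where
  toFun v := ∑ j, v (.inr j) • Polynomial.X ^ (j : ℕ)
  map_add' v w := by simp [add_smul, Finset.sum_add_distrib]
  map_smul' c v := by simp [mul_smul, Finset.smul_sum]

theorem leftPoly_apply (v : Idx m n → k) :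
    leftPoly v = ∑ i, v (.inl i) • Polynomial.X ^ (i : ℕ) := rfl

theorem rightPoly_apply (v : Idx m n → k) :
    rightPoly v = ∑ j, v (.inr j) • Polynomial.X ^ (j : ℕ) := rfl

theorem natDegree_leftPoly_le (v : Idx m n → k) : (leftPoly v).natDegree ≤ m := by
  rw [leftPoly_apply]
  exact Polynomial.natDegree_sum_le_of_forall_le _ _ fun i _ =>
    (Polynomial.natDegree_smul_le _ _).trans
      ((Polynomial.natDegree_X_pow_le _).trans (Nat.lt_succ_iff.1 i.2))

theorem natDegree_rightPoly_le (v : Idx m n → k) : (rightPoly v).natDegree ≤ n := by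
  rw [rightPoly_apply]
  exact Polynomial.natDegree_sum_le_of_forall_le _ _ fun i _ =>
    (Polynomial.natDegree_smul_le _ _).trans
      ((Polynomial.natDegree_X_pow_le _).trans (Nat.lt_succ_iff.1 i.2))

theorem coeff_leftPoly (v : Idx m n → k) (i : Fin (m + 1)) :
    (leftPoly v).coeff i = v (.inl i) := by
  simp [leftPoly_apply, Polynomial.finsetSum_coeff, Polynomial.coeff_X_pow, Fin.val_inj]

theorem coeff_rightPoly (v : Idx m n → k) (i : Fin (n + 1)) :
    (rightPoly v).coeff i = v (.inr i) := by
  simp [rightPoly_apply, Polynomial.finsetSum_coeff, Polynomial.coeff_X_pow, Fin.val_inj]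

theorem dotProduct_scrollVec (v : Idx m n → k) (s t : k) :
    v ⬝ᵥ scrollVec k m n s t = (leftPoly v).eval s + t * (rightPoly v).eval s := by
  simp only [dotProduct, Fintype.sum_sum_type, leftPoly_apply, rightPoly_apply,
    Polynomial.eval_finsetSum, Polynomial.eval_smul, Polynomial.eval_pow, Polynomial.eval_X,
    smul_eq_mul, scrollVec, Sum.elim_inl, Sum.elim_inr, Finset.mul_sum]
  congr 1
  exact Finset.sum_congr rfl fun j _ => by ring

theorem eq_zero_of_eval_add_mul_add_sq_mul [CharZero k] {p₀ p₁ p₂ : Polynomial k}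
    (h : ∀ s t : k, p₀.eval s + t * p₁.eval s + t ^ 2 * p₂.eval s = 0) :
    p₀ = 0 ∧ p₁ = 0 ∧ p₂ = 0 := by
  refine ⟨Polynomial.funext fun s => ?_, Polynomial.funext fun s => ?_,
    Polynomial.funext fun s => ?_⟩ <;> rw [Polynomial.eval_zero]
  · linear_combination h s 0
  · linear_combination (h s 1) / 2 - (h s (-1)) / 2
  · linear_combination (h s 1) / 2 + (h s (-1)) / 2 - h s 0

/-- The recursion satisfied by the blocks of an infinitesimal automorphism. It says that `A i` is
the image of `sⁱ` under the operator `f ↦ A 0 * f - d * f'`. -/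
theorem eq_of_recursion {N : ℕ} {A : Fin (N + 1) → Polynomial k} {d : Polynomial k}
    (h : ∀ i : Fin N, A i.succ = .X * A i.castSucc - .X ^ (i : ℕ) * d) (i : Fin (N + 1)) :
    A i = .X ^ (i : ℕ) * A 0 - Polynomial.derivative (.X ^ (i : ℕ)) * d := by
  induction i using Fin.induction with
  | zero => simp
  | succ i ih =>
    rw [h, ih, Fin.val_succ, Fin.val_castSucc, pow_succ, Polynomial.derivative_mul,
      Polynomial.derivative_X]
    ring

theorem natDegree_le_two_of_recursion {N : ℕ} (hN : 1 ≤ N) {A : Fin (N + 1) → Polynomial k}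
    {d : Polynomial k} (hA : ∀ i, (A i).natDegree ≤ N)
    (h : ∀ i : Fin N, A i.succ = .X * A i.castSucc - .X ^ (i : ℕ) * d) : d.natDegree ≤ 2 := by
  rw [Polynomial.natDegree_le_iff_coeff_eq_zero]
  intro l hl
  obtain ⟨N, rfl⟩ : ∃ N', N = N' + 1 := ⟨N - 1, by omega⟩
  have h1 := congrArg (fun p => Polynomial.coeff p (l + N)) (h (Fin.last N))
  obtain ⟨r, hr⟩ : ∃ r, l + N = r + 1 := ⟨l + N - 1, by omega⟩
  have h2 := Polynomial.natDegree_le_iff_coeff_eq_zero.1 (hA (Fin.last N).succ) (l + N) (by omega)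
  have h3 := Polynomial.natDegree_le_iff_coeff_eq_zero.1 (hA (Fin.last N).castSucc) r (by omega)
  simp only [Polynomial.coeff_sub, Fin.val_last, Polynomial.coeff_X_pow_mul] at h1
  rw [h2, hr, Polynomial.coeff_X_mul, h3] at h1
  simpa using h1.symm

/-- The bound on the degrees in the recursion determines `A 0` up to a constant: it is the term by
which the vector field `-d ∂/∂s` is twisted on sections of `𝒪(N)`. -/
theorem exists_eq_C_add_derivative [CharZero k] {N : ℕ} {A : Fin (N + 1) → Polynomial k}
    {d : Polynomial k} (hd : d.natDegree ≤ 2) (hA : ∀ i, (A i).natDegree ≤ N)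
    (h : ∀ i : Fin N, A i.succ = .X * A i.castSucc - .X ^ (i : ℕ) * d) :
    ∃ c : k, A 0 = .C c + .C (N / 2 : k) * Polynomial.derivative d := by
  have hd' := Polynomial.natDegree_le_iff_coeff_eq_zero.1 hd
  refine ⟨(A 0).coeff 0 - N / 2 * d.coeff 1, ?_⟩
  have key : ∀ l, 1 ≤ l → (A 0).coeff l = N * d.coeff (l + 1) := by
    intro l hl
    have h1 := eq_of_recursion h (Fin.last N)
    have h2 := Polynomial.natDegree_le_iff_coeff_eq_zero.1 (hA (Fin.last N)) (l + N) (by omega)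
    rw [h1, Polynomial.coeff_sub, Fin.val_last, Polynomial.coeff_X_pow_mul,
      Polynomial.derivative_X_pow, mul_assoc, Polynomial.coeff_C_mul] at h2
    rcases N with - | N
    · simpa using h2
    · rw [Nat.add_sub_cancel, show l + (N + 1) = l + 1 + N by ring,
        Polynomial.coeff_X_pow_mul] at h2
      linear_combination h2
  ext l
  rw [Polynomial.coeff_add, Polynomial.coeff_C_mul, Polynomial.coeff_derivative]
  rcases l with - | _ | l
  · simp
  · rw [key _ le_rfl, Polynomial.coeff_C_succ]
    push_cast
    ring
  · rw [key _ (by omega), hd' _ (by omega), Polynomial.coeff_C_succ]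
    ring

theorem sum_smul_eq_of_recursion {N : ℕ} {A : Fin (N + 1) → Polynomial k} {d : Polynomial k}
    (h : ∀ i : Fin N, A i.succ = .X * A i.castSucc - .X ^ (i : ℕ) * d) (c : Fin (N + 1) → k) :
    ∑ i, c i • A i = A 0 * (∑ i, c i • .X ^ (i : ℕ)) -
      d * Polynomial.derivative (∑ i, c i • .X ^ (i : ℕ)) := by
  rw [map_sum, Finset.mul_sum, Finset.mul_sum, ← Finset.sum_sub_distrib]
  refine Finset.sum_congr rfl fun i _ => ?_
  rw [eq_of_recursion h i, Polynomial.derivative_smul]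
  simp only [Polynomial.smul_eq_C_mul]
  ring

/-- The shape of the Lie algebra of the scroll. An infinitesimal automorphism acts on the linear
forms in the first block, seen as polynomials of degree at most `m` in `s`, by a vector field
`-d ∂/∂s` of the projective line twisted by `m`, and on the quotient by these forms by the same
vector field twisted by `n`. -/
theorem exists_vectorField_of_mem_glLie [CharZero k] (hmn : n < m) (h2 : 2 ≤ m)
    {g : (Idx m n → k) ≃ₗ[k] (Idx m n → k)}
    {M : Matrix (Idx m n) (Idx m n) k} (hM : M ∈ glLie (g • scroll k m n)) :
    ∃ (d : Polynomial k) (c₁ c₂ : k), d.natDegree ≤ 2 ∧ ∀ v : Idx m n → k,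
      let G := LinearMap.toMatrix' (g : (Idx m n → k) →ₗ[k] (Idx m n → k))
      rightPoly ((v ᵥ* M) ᵥ* G) =
        (.C c₂ + .C (n / 2 : k) * Polynomial.derivative d) * rightPoly (v ᵥ* G) -
          d * Polynomial.derivative (rightPoly (v ᵥ* G)) ∧
      (rightPoly (v ᵥ* G) = 0 → leftPoly ((v ᵥ* M) ᵥ* G) =
        (.C c₁ + .C (m / 2 : k) * Polynomial.derivative d) * leftPoly (v ᵥ* G) -
          d * Polynomial.derivative (leftPoly (v ᵥ* G))) := by
  set G := LinearMap.toMatrix' (g : (Idx m n → k) →ₗ[k] (Idx m n → k)) with hG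
  set G' := LinearMap.toMatrix' (g.symm : (Idx m n → k) →ₗ[k] (Idx m n → k)) with hG'
  have hGG' : G * G' = 1 := by
    rw [hG, hG', ← LinearMap.toMatrix'_comp]
    simp
  set M' := G' * M * G with hM'
  set A : Idx m n → Polynomial k := fun r => leftPoly (M' r) with hA
  set B : Idx m n → Polynomial k := fun r => rightPoly (M' r) with hB
  have hf : ∀ s t r, g.symm (M *ᵥ g (scrollVec k m n s t)) r =
      (A r).eval s + t * (B r).eval s := by
    intro s t r
    rw [hA, hB, ← dotProduct_scrollVec]
    have h1 : G *ᵥ scrollVec k m n s t = g (scrollVec k m n s t) := LinearMap.toMatrix'_mulVec _ _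
    have h3 : G' *ᵥ (M *ᵥ g (scrollVec k m n s t)) = g.symm (M *ᵥ g (scrollVec k m n s t)) :=
      LinearMap.toMatrix'_mulVec _ _
    rw [← h3, ← h1, Matrix.mulVec_mulVec, Matrix.mulVec_mulVec]
    rfl
  have hm0 : 0 < m := by omega
  set i₀ : Fin m := ⟨0, hm0⟩ with hi₀
  set d : Polynomial k := .X * A (.inl i₀.castSucc) - A (.inl i₀.succ) with hd
  set e : Polynomial k := .X * B (.inl i₀.castSucc) - B (.inl i₀.succ) with he
  have hmin : ∀ s t j, (A (hiIdx j)).eval s + t * (B (hiIdx j)).eval s =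
      s * ((A (loIdx j)).eval s + t * (B (loIdx j)).eval s) -
        (d.eval s + t * e.eval s) * scrollVec k m n s t (loIdx j) := by
    intro s t j
    have := minor_diff_eq_zero hM s t rfl (.inl i₀) j
    simp only [hf, scrollVec_hiIdx] at this
    have hlo : scrollVec k m n s t (loIdx (.inl i₀)) = 1 := by simp [scrollVec, loIdx, hi₀]
    rw [hlo] at this
    simp only [hd, he, Polynomial.eval_sub, Polynomial.eval_mul, Polynomial.eval_X]
    simp only [loIdx, hiIdx, Sum.map_inl] at this ⊢
    linear_combination this
  have hL : ∀ i : Fin m, A (.inl i.succ) = .X * A (.inl i.castSucc) - .X ^ (i : ℕ) * d ∧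
      B (.inl i.succ) = .X * B (.inl i.castSucc) - .X ^ (i : ℕ) * e := by
    intro i
    obtain ⟨h1, h3, -⟩ := eq_zero_of_eval_add_mul_add_sq_mul
      (p₀ := A (.inl i.succ) - (.X * A (.inl i.castSucc) - .X ^ (i : ℕ) * d))
      (p₁ := B (.inl i.succ) - (.X * B (.inl i.castSucc) - .X ^ (i : ℕ) * e)) (p₂ := 0)
      (fun s t => by
        have := hmin s t (.inl i)
        simp only [loIdx, hiIdx, Sum.map_inl, scrollVec, Sum.elim_inl, Fin.val_castSucc] at this
        simp
        linear_combination this)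
    exact ⟨sub_eq_zero.1 h1, sub_eq_zero.1 h3⟩
  have hR : ∀ j : Fin n, B (.inr j.succ) = .X * B (.inr j.castSucc) - .X ^ (j : ℕ) * d ∧
      Polynomial.X ^ (j : ℕ) * e = 0 := by
    intro j
    obtain ⟨-, h1, h3⟩ := eq_zero_of_eval_add_mul_add_sq_mul
      (p₀ := A (.inr j.succ) - .X * A (.inr j.castSucc))
      (p₁ := B (.inr j.succ) - (.X * B (.inr j.castSucc) - .X ^ (j : ℕ) * d))
      (p₂ := .X ^ (j : ℕ) * e)
      (fun s t => by
        have := hmin s t (.inr j)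
        simp only [loIdx, hiIdx, Sum.map_inr, scrollVec, Sum.elim_inr, Fin.val_castSucc] at this
        simp
        linear_combination this)
    exact ⟨sub_eq_zero.1 h1, h3⟩
  have hBdeg : ∀ r, (B r).natDegree ≤ n := fun r => natDegree_rightPoly_le _
  have hAdeg : ∀ r, (A r).natDegree ≤ m := fun r => natDegree_leftPoly_le _
  have hB0 : B (.inl 0) = 0 ∧ e = 0 := by
    have h01 : i₀.castSucc = 0 := rfl
    rcases Nat.eq_zero_or_pos n with hn | hn
    · -- On a cone the entries of the upper right block are constants, and those in the rows
      -- `0`, `1` and `2` are related by the recursion.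
      have hc : ∀ r, ∃ b : k, B r = .C b := fun r =>
        ⟨_, Polynomial.eq_C_of_natDegree_le_zero ((hBdeg r).trans hn.le)⟩
      obtain ⟨b₀, hb₀⟩ := hc (.inl 0)
      obtain ⟨b₁, hb₁⟩ := hc (.inl i₀.succ)
      obtain ⟨b₂, hb₂⟩ := hc (.inl (⟨1, by omega⟩ : Fin m).succ)
      have h3 := (hL ⟨1, by omega⟩).2
      have h4 : (⟨1, by omega⟩ : Fin m).castSucc = i₀.succ := by simp [hi₀]
      rw [h4, hb₂, he, h01, hb₀, hb₁] at h3
      have e1 := congrArg (fun p => Polynomial.coeff p 1) h3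
      have e2 := congrArg (fun p => Polynomial.coeff p 2) h3
      have e3 : (Polynomial.X * Polynomial.C b₁ - Polynomial.X ^ 1 *
          (Polynomial.X * Polynomial.C b₀ - Polynomial.C b₁) : Polynomial k) =
          Polynomial.C (2 * b₁) * Polynomial.X ^ 1 - Polynomial.C b₀ * Polynomial.X ^ 2 := by
        simp only [map_mul, Polynomial.C_ofNat]
        ring
      simp only [e3, Polynomial.coeff_sub, Polynomial.coeff_C_mul, Polynomial.coeff_X_pow,
        Polynomial.coeff_C] at e1 e2
      norm_num at e1 e2
      simp [he, h01, hb₀, hb₁, e1, e2]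
    · have he0 : e = 0 := by simpa using (hR ⟨0, hn⟩).2
      refine ⟨?_, he0⟩
      have h3 := eq_of_recursion (A := fun i => B (.inl i)) (d := e) (fun i => (hL i).2)
        (Fin.last m)
      rw [he0, mul_zero, sub_zero, Fin.val_last] at h3
      ext l
      have h4 := Polynomial.natDegree_le_iff_coeff_eq_zero.1 (hBdeg (.inl (Fin.last m))) (l + m)
        (by omega)
      rw [h3, Polynomial.coeff_X_pow_mul] at h4
      simpa using h4
  have hBzero : ∀ i : Fin (m + 1), B (.inl i) = 0 := by
    intro i
    have := eq_of_recursion (A := fun i => B (.inl i)) (d := e) (fun i => (hL i).2) i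
    simpa [hB0.1, hB0.2] using this
  have hd2 : d.natDegree ≤ 2 := natDegree_le_two_of_recursion (A := fun i => A (.inl i))
    hm0 (fun _ => hAdeg _) (fun i => (hL i).1)
  obtain ⟨c₁, hc₁⟩ := exists_eq_C_add_derivative (A := fun i => A (.inl i)) hd2
    (fun _ => hAdeg _) (fun i => (hL i).1)
  obtain ⟨c₂, hc₂⟩ := exists_eq_C_add_derivative (A := fun i => B (.inr i)) hd2
    (fun _ => hBdeg _) (fun i => (hR i).1)
  refine ⟨d, c₁, c₂, hd2, fun v => ?_⟩
  intro G
  have hv : (v ᵥ* M) ᵥ* G = (v ᵥ* G) ᵥ* M' := by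
    rw [hM', Matrix.vecMul_vecMul, Matrix.vecMul_vecMul, ← mul_assoc, ← mul_assoc, hGG', one_mul]
  have hsum : (v ᵥ* G) ᵥ* M' = ∑ r, (v ᵥ* G) r • M' r := Matrix.vecMul_eq_sum _ _
  set u := v ᵥ* G with hu
  rw [hv, hsum]
  constructor
  · rw [map_sum, Fintype.sum_sum_type]
    simp only [map_smul]
    rw [Finset.sum_eq_zero (s := Finset.univ (α := Fin (m + 1))), zero_add, rightPoly_apply u]
    · rw [← hc₂]
      exact sum_smul_eq_of_recursion (A := fun j => B (.inr j)) (fun i => (hR i).1) _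
    · intro i _
      rw [show rightPoly (M' (.inl i)) = 0 from hBzero i, smul_zero]
  · intro hu0
    have hu0' : ∀ j, u (.inr j) = 0 := fun j => by rw [← coeff_rightPoly u, hu0]; simp
    rw [map_sum, Fintype.sum_sum_type]
    simp only [map_smul]
    rw [Finset.sum_eq_zero (s := Finset.univ (α := Fin (n + 1))), add_zero, leftPoly_apply u]
    · rw [← hc₁]
      exact sum_smul_eq_of_recursion (A := fun j => A (.inl j)) (fun i => (hL i).1) _
    · intro i _
      rw [hu0', zero_smul]

end InfinitesimalAutomorphisms

/-! ### Twisted vector fields on the projective line -/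

section VectorFields

open Polynomial

variable {k : Type*} [Field k]

/-- The action of the vector field `d ∂/∂s` on the sections of `𝒪(N)` over the projective line,
written as polynomials in the affine coordinate `s`. -/
def twistOp (N : ℕ) (d f : k[X]) : k[X] :=
  d * derivative f - C (N / 2 : k) * derivative d * f

theorem twistOp_commutator (N : ℕ) (d e f : k[X]) :
    twistOp N d (twistOp N e f) - twistOp N e (twistOp N d f) =
      twistOp N (d * derivative e - e * derivative d) f := by
  simp only [twistOp, derivative_sub, derivative_mul, derivative_C]
  ring

theorem exists_coeffs_of_natDegree_le_two {p : k[X]} (hp : p.natDegree ≤ 2) :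
    ∃ a b c : k, p = C a + C b * X + C c * X ^ 2 := by
  refine ⟨p.coeff 0, p.coeff 1, p.coeff 2, ?_⟩
  conv_lhs => rw [p.as_sum_range_C_mul_X_pow' (Nat.lt_succ_of_le hp)]
  simp [Finset.sum_range_succ]

theorem coeffs_eq_zero_of_quadratic {a b c : k} (h : C a + C b * X + C c * X ^ 2 = 0) :
    a = 0 ∧ b = 0 ∧ c = 0 := by
  have h0 := congrArg (fun p => coeff p 0) h
  have h1 := congrArg (fun p => coeff p 1) h
  have h2 := congrArg (fun p => coeff p 2) h
  simp [coeff_X, coeff_C, coeff_X_pow] at h0 h1 h2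
  exact ⟨h0, h1, h2⟩

/-- If `[H, E] = 2E` with `E ≠ 0`, then `E` is nilpotent, that is, `E = ℓ²` vanishes doubly at one
point of the projective line, and this point is one of the two zeros of `H`. -/
theorem exists_factorization [IsAlgClosed k] [CharZero k] {E H : k[X]} (hE : E.natDegree ≤ 2)
    (hH : H.natDegree ≤ 2) (hE0 : E ≠ 0) (h : H * derivative E - E * derivative H = 2 * E) :
    ∃ α β γ δ : k, α * δ - β * γ = -2 ∧ E = (C α + C β * X) ^ 2 ∧
      H = (C α + C β * X) * (C γ + C δ * X) := by
  obtain ⟨x₀, x₁, x₂, rfl⟩ := exists_coeffs_of_natDegree_le_two hE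
  obtain ⟨h₀, h₁, h₂, rfl⟩ := exists_coeffs_of_natDegree_le_two hH
  have hc : C (h₀ * x₁ - h₁ * x₀ - 2 * x₀) + C (2 * (h₀ * x₂ - h₂ * x₀ - x₁)) * X +
      C (h₁ * x₂ - h₂ * x₁ - 2 * x₂) * X ^ 2 = 0 := by
    simp only [derivative_add, derivative_mul, derivative_C, derivative_X, derivative_X_pow,
      Nat.cast_ofNat, C_ofNat] at h
    simp only [map_sub, map_mul, C_ofNat]
    linear_combination h
  obtain ⟨e0, e1, e2⟩ := coeffs_eq_zero_of_quadratic hc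
  replace e1 : h₀ * x₂ - h₂ * x₀ - x₁ = 0 := by simpa using e1
  -- The discriminant of `E` vanishes.
  have hdisc : x₁ ^ 2 = 4 * x₀ * x₂ := by
    linear_combination (-x₁) * e1 + x₂ * e0 + x₀ * e2
  obtain ⟨α, hα⟩ := IsAlgClosed.exists_pow_nat_eq x₀ (n := 2) (by norm_num)
  obtain ⟨β, hβ, hαβ⟩ : ∃ β, β ^ 2 = x₂ ∧ 2 * α * β = x₁ := by
    obtain ⟨β, hβ⟩ := IsAlgClosed.exists_pow_nat_eq x₂ (n := 2) (by norm_num)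
    have : (2 * α * β - x₁) * (2 * α * β + x₁) = 0 := by
      linear_combination 4 * β ^ 2 * hα + 4 * x₀ * hβ - hdisc
    rcases mul_eq_zero.1 this with h | h
    · exact ⟨β, hβ, sub_eq_zero.1 h⟩
    · exact ⟨-β, by rw [neg_sq, hβ], by linear_combination -h⟩
  subst hα hβ hαβ
  have two : (2 : k) ≠ 0 := two_ne_zero
  by_cases hα0 : α = 0
  · subst hα0
    have hβ0 : β ≠ 0 := by
      rintro rfl
      simp at hE0
    have e1' : h₀ = 0 := by
      have : h₀ * β ^ 2 = 0 := by linear_combination e1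
      simpa [hβ0] using this
    have e2' : h₁ = 2 := by
      have : (h₁ - 2) * β ^ 2 = 0 := by linear_combination e2
      simpa [hβ0, sub_eq_zero] using this
    subst e1' e2'
    refine ⟨0, β, 2 / β, h₂ / β, ?_, ?_, ?_⟩
    · field_simp
      ring
    · simp [mul_pow]
    · have : (C β * C (2 / β) : k[X]) = C 2 := by rw [← map_mul]; congr 1; field_simp
      have h3 : (C β * C (h₂ / β) : k[X]) = C h₂ := by rw [← map_mul]; congr 1; field_simp
      simp only [map_zero]
      linear_combination (-X : k[X]) * this - X ^ 2 * h3
  · have e0' : 2 * β * h₀ = (h₁ + 2) * α := by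
      have : α * (2 * β * h₀ - (h₁ + 2) * α) = 0 := by linear_combination e0
      simpa [hα0, sub_eq_zero] using this
    refine ⟨α, β, h₀ / α, (h₁ - β * (h₀ / α)) / α, ?_, ?_, ?_⟩
    · field_simp
      linear_combination -e0'
    · simp only [map_mul, map_pow, C_ofNat]
      ring
    · have g0 : (C α * C (h₀ / α) : k[X]) = C h₀ := by rw [← map_mul]; congr 1; field_simp
      have g1 : (C α * C ((h₁ - β * (h₀ / α)) / α) : k[X]) = C h₁ - C β * C (h₀ / α) := by
        rw [← map_mul, ← map_mul, ← map_sub]; congr 1; field_simp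
      have g2 : (C β * C ((h₁ - β * (h₀ / α)) / α) : k[X]) = C h₂ := by
        rw [← map_mul]; congr 1; field_simp
        have : α * (β * (α * h₁ - β * h₀) - h₂ * α ^ 2) = 0 := by
          linear_combination α * e1 - α * β * e0'
        have := (mul_eq_zero.1 this).resolve_left hα0
        linear_combination this
      linear_combination -g0 - X * g1 - X ^ 2 * g2

theorem linear_mul_derivative_pow (α β : k) (N : ℕ) :
    (C α + C β * X) * derivative ((C α + C β * X) ^ N) =
      C (N * β) * (C α + C β * X) ^ N := by
  rcases N with - | N
  · simp
  · simp only [derivative_pow, derivative_add, derivative_C, derivative_mul, derivative_X,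
      Nat.add_sub_cancel, map_mul]
    ring

theorem eq_C_mul_linear_pow [CharZero k] {α β : k} (hαβ : α ≠ 0 ∨ β ≠ 0) {N : ℕ} {f : k[X]}
    (hf : f.natDegree ≤ N) (h : (C α + C β * X) * derivative f = C (N * β) * f) :
    ∃ c, f = C c * (C α + C β * X) ^ N := by
  induction N generalizing f with
  | zero => exact ⟨f.coeff 0, by simpa using eq_C_of_natDegree_le_zero hf⟩
  | succ N ih =>
    by_cases hβ : β = 0
    · subst hβ
      have hα : α ≠ 0 := by simpa using hαβ
      have h0 : derivative f = 0 := by simpa [hα] using h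
      have hb := eq_C_of_natDegree_eq_zero (derivative_eq_zero.1 h0)
      refine ⟨f.coeff 0 / α ^ (N + 1), ?_⟩
      rw [hb, coeff_C_zero, map_zero, zero_mul, add_zero, ← C_pow, ← C_mul,
        div_mul_cancel₀ _ (pow_ne_zero _ hα)]
    · obtain ⟨c, hc⟩ := ih (f := derivative f) ((natDegree_derivative_le f).trans (by omega)) (by
        have := congrArg derivative h
        simp only [derivative_mul, derivative_add, derivative_C, derivative_X, Nat.cast_succ,
          C_mul, C_add, C_1, derivative_one] at this
        simp only [map_mul]
        linear_combination this)
      have hN : ((N : k) + 1) ≠ 0 := Nat.cast_add_one_ne_zero N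
      refine ⟨c / ((N + 1) * β), ?_⟩
      rw [hc] at h
      have h1 : (C (1 / ((N + 1) * β)) * C ((N + 1 : ℕ) * β) : k[X]) = 1 := by
        rw [← C_mul, ← C_1]
        congr 1
        push_cast
        field_simp
      have h3 : (C (c / ((N + 1) * β)) : k[X]) = C c * C (1 / ((N + 1) * β)) := by
        rw [← C_mul, mul_one_div]
      rw [h3, pow_succ]
      linear_combination (-f) * h1 - C (1 / ((N + 1) * β)) * h

theorem linear_ne_zero {α β : k} (h : α ≠ 0 ∨ β ≠ 0) : (C α + C β * X : k[X]) ≠ 0 := by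
  intro h0
  have := coeffs_eq_zero_of_quadratic (a := α) (b := β) (c := 0) (by simpa using h0)
  tauto

theorem eq_C_mul_linear_pow_of_twistOp_eq_zero [CharZero k] {α β : k} (hαβ : α ≠ 0 ∨ β ≠ 0)
    {N : ℕ} {f : k[X]} (hf : f.natDegree ≤ N) (h : twistOp N ((C α + C β * X) ^ 2) f = 0) :
    ∃ c, f = C c * (C α + C β * X) ^ N := by
  refine eq_C_mul_linear_pow hαβ hf ?_
  refine mul_left_cancel₀ (linear_ne_zero hαβ) ?_
  have h2 : (C (N / 2 : k) * 2 : k[X]) = C (N : k) := by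
    rw [← C_ofNat, ← C_mul, div_mul_cancel₀ _ two_ne_zero]
  simp only [twistOp, derivative_pow, derivative_add, derivative_C, derivative_mul, derivative_X,
    Nat.cast_ofNat, C_ofNat] at h
  rw [C_mul]
  linear_combination h + (C α + C β * X) * C β * f * h2

theorem twistOp_linear_mul_linear [CharZero k] {α β γ δ : k} (h : α * δ - β * γ = -2) (N : ℕ) :
    twistOp N ((C α + C β * X) * (C γ + C δ * X)) ((C α + C β * X) ^ N) =
      C (N : k) * (C α + C β * X) ^ N := by
  have h1 := linear_mul_derivative_pow α β N
  have h2 : (C (N / 2 : k) * 2 : k[X]) = C (N : k) := by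
    rw [← C_ofNat, ← C_mul, div_mul_cancel₀ _ two_ne_zero]
  have h3 : (C α * C δ - C β * C γ : k[X]) = -2 := by
    rw [← C_mul, ← C_mul, ← C_sub, h, C_neg, C_ofNat]
  rw [C_mul] at h1
  simp only [twistOp, derivative_add, derivative_C, derivative_mul, derivative_X]
  rw [← h2] at h1 ⊢
  linear_combination (C γ + C δ * X) * h1 - C (N / 2 : k) * (C α + C β * X) ^ N * h3

theorem twistOp_linear_pow [CharZero k] {α β : k} {F l : k[X]} (hαβ : α ≠ 0 ∨ β ≠ 0)
    (h : (C α + C β * X) ^ 2 * derivative F - F * derivative ((C α + C β * X) ^ 2) =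
      (C α + C β * X) * l) (N : ℕ) :
    twistOp (N + 1) F ((C α + C β * X) ^ (N + 1)) =
      C (-((N + 1 : ℕ) / 2 : k)) * ((C α + C β * X) ^ N * l) := by
  have h2 : (C ((N + 1 : ℕ) / 2 : k) * 2 : k[X]) = C ((N + 1 : ℕ) : k) := by
    rw [← C_ofNat, ← C_mul, div_mul_cancel₀ _ two_ne_zero]
  have h4 : (C α + C β * X) * derivative F - 2 * C β * F = l := by
    refine mul_left_cancel₀ (linear_ne_zero hαβ) ?_
    rw [← h]
    simp only [derivative_pow, derivative_add, derivative_C, derivative_mul, derivative_X,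
      Nat.cast_ofNat, C_ofNat]
    ring
  have h5 : derivative ((C α + C β * X) ^ (N + 1)) =
      C ((N + 1 : ℕ) : k) * (C α + C β * X) ^ N * C β := by
    simp only [derivative_pow, derivative_add, derivative_C, derivative_mul, derivative_X,
      Nat.add_sub_cancel]
    ring
  rw [twistOp, h5, ← h2, ← h4, C_neg, pow_succ]
  ring

end VectorFields

/-! ### The highest weight vector -/

section HighestWeight

open Polynomial

variable {k V : Type*} [Field k] [AddCommGroup V] [Module k V]

/-- An extension `0 → ker Q → V → V / ker Q → 0` is given by linear maps `P, Q` to polynomials.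
The operator `φ` on `V` acts on the quotient as the vector field `d ∂/∂s` twisted by `n` and on
`ker Q` as the same vector field twisted by `m`, up to the addition of scalars `-c₂` and `-c₁`. -/
def ActsBy (m n : ℕ) (P Q : V →ₗ[k] k[X]) (φ : V →ₗ[k] V) (d : k[X]) (c₁ c₂ : k) : Prop :=
  ∀ v, Q (φ v) = twistOp n d (Q v) - C c₂ * Q v ∧
    (Q v = 0 → P (φ v) = twistOp m d (P v) - C c₁ * P v)

variable {m n : ℕ} {P Q : V →ₗ[k] k[X]}

theorem ActsBy.smul {φ : V →ₗ[k] V} {d : k[X]} {c₁ c₂ : k} (h : ActsBy m n P Q φ d c₁ c₂) (r : k) :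
    ActsBy m n P Q (r • φ) (C r * d) (r * c₁) (r * c₂) := by
  intro v
  refine ⟨?_, fun hv => ?_⟩
  · rw [LinearMap.smul_apply, map_smul, (h v).1, smul_eq_C_mul]
    simp only [twistOp, derivative_mul, derivative_C, C_mul]
    ring
  · rw [LinearMap.smul_apply, map_smul, (h v).2 hv, smul_eq_C_mul]
    simp only [twistOp, derivative_mul, derivative_C, C_mul]
    ring

/-- The vector field of a commutator is the bracket of vector fields, and the scalars of a
commutator vanish. -/
theorem ActsBy.of_commutator {φ ψ χ : V →ₗ[k] V} {d e f : k[X]} {c₁ c₂ c₁' c₂' c₁'' c₂'' : k}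
    (hφ : ActsBy m n P Q φ d c₁ c₂) (hψ : ActsBy m n P Q ψ e c₁' c₂')
    (hχ : ActsBy m n P Q χ f c₁'' c₂'') (h : ∀ v, χ v = φ (ψ v) - ψ (φ v))
    (h1 : ∃ v, Q v = 0 ∧ P v = 1) (hX : ∃ v, Q v = 0 ∧ P v = X) (hQ : ∃ v, Q v = 1) :
    f = d * derivative e - e * derivative d ∧ c₁'' = 0 ∧ c₂'' = 0 := by
  have key : ∀ v, Q v = 0 → twistOp m f (P v) - C c₁'' * P v =
      twistOp m (d * derivative e - e * derivative d) (P v) := by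
    intro v hv
    have h1 : Q (φ v) = 0 := by rw [(hφ v).1, hv]; simp [twistOp]
    have h2 : Q (ψ v) = 0 := by rw [(hψ v).1, hv]; simp [twistOp]
    rw [← (hχ v).2 hv, h, map_sub, (hφ _).2 h2, (hψ _).2 h1, (hφ _).2 hv, (hψ _).2 hv,
      ← twistOp_commutator]
    simp only [twistOp, derivative_sub, derivative_mul, derivative_C]
    ring
  have key2 : ∀ v, twistOp n f (Q v) - C c₂'' * Q v =
      twistOp n (d * derivative e - e * derivative d) (Q v) := by
    intro v
    rw [← (hχ v).1, h, map_sub, (hφ (ψ v)).1, (hψ (φ v)).1, (hφ v).1,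
      (hψ v).1, ← twistOp_commutator]
    simp only [twistOp, derivative_sub, derivative_mul, derivative_C]
    ring
  obtain ⟨v₁, hv₁, h1⟩ := h1
  obtain ⟨v₂, hv₂, hX⟩ := hX
  obtain ⟨v₃, hQ⟩ := hQ
  have k1 := key v₁ hv₁
  have k2 := key v₂ hv₂
  have k3 := key2 v₃
  rw [h1] at k1
  rw [hX] at k2
  rw [hQ] at k3
  have hf : f = d * derivative e - e * derivative d := by
    simp only [twistOp, derivative_one, derivative_X] at k1 k2
    linear_combination k2 - X * k1
  refine ⟨hf, ?_, ?_⟩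
  · rw [← hf] at k1
    simpa using k1
  · rw [← hf] at k3
    simpa using k3

/-- The core of the argument: for an `𝔰𝔩₂`-triple `x, h, y` acting by twisted vector fields, a
vector `v` of maximal weight is, up to a scalar, the `m`-th power of the linear form `ℓ` whose
square is the vector field of `x`, and `y v` is a multiple of `ℓᵐ⁻¹ ℓ'` for an independent linear
form `ℓ'`. The weights on the quotient are at most `n < m`, which forces `v` into `ker Q`. -/
theorem highestWeight_eq_pow [IsAlgClosed k] [CharZero k] (hmn : n < m)
    (hP : ∀ v, Q v = 0 → (P v).natDegree ≤ m)
    (hQ : ∀ v, (Q v).natDegree ≤ n) (hinj : ∀ v, P v = 0 → Q v = 0 → v = 0)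
    (hsurj : ∀ f : k[X], f.natDegree ≤ m → ∃ v, Q v = 0 ∧ P v = f) (hQ1 : ∃ v, Q v = 1)
    {x h y : V →ₗ[k] V} (hxy : ∀ v, h v = x (y v) - y (x v))
    (hhx : ∀ v, (2 : k) • x v = h (x v) - x (h v))
    (hhy : ∀ v, (-2 : k) • y v = h (y v) - y (h v)) (hh : h ≠ 0)
    {E H F : k[X]} {cx₁ cx₂ ch₁ ch₂ cy₁ cy₂ : k} (hE : E.natDegree ≤ 2) (hH : H.natDegree ≤ 2)
    (ax : ActsBy m n P Q x E cx₁ cx₂) (ah : ActsBy m n P Q h H ch₁ ch₂)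
    (ay : ActsBy m n P Q y F cy₁ cy₂) {a : ℤ} {v : V} (hv0 : v ≠ 0) (hv : h v = (a : k) • v)
    (hmax : ∀ (b : ℤ) (u : V), u ≠ 0 → h u = (b : k) • u → b ≤ a) :
    ∃ α β γ δ c : k, α * δ - β * γ ≠ 0 ∧ c ≠ 0 ∧
      Q v = 0 ∧ P v = C c * (C α + C β * X) ^ m ∧
      Q (y v) = 0 ∧ P (y v) =
        C (-(m / 2 : k) * c) * ((C α + C β * X) ^ (m - 1) * (C γ + C δ * X)) := by
  have s1 : ∃ v, Q v = 0 ∧ P v = 1 := hsurj 1 (by simp)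
  have sX : ∃ v, Q v = 0 ∧ P v = X := hsurj X (by simp; omega)
  obtain ⟨bh, rfl, rfl⟩ := ax.of_commutator ay ah hxy s1 sX hQ1
  obtain ⟨bx, hcx₁, hcx₂⟩ := ah.of_commutator ax (ax.smul 2) hhx s1 sX hQ1
  obtain ⟨bY, hcy₁, hcy₂⟩ := ah.of_commutator ay (ay.smul (-2)) hhy s1 sX hQ1
  obtain rfl : cx₁ = 0 := by simpa using hcx₁
  obtain rfl : cx₂ = 0 := by simpa using hcx₂
  obtain rfl : cy₁ = 0 := by simpa using hcy₁
  obtain rfl : cy₂ = 0 := by simpa using hcy₂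
  have ax' : ∀ v, Q (x v) = twistOp n E (Q v) ∧ (Q v = 0 → P (x v) = twistOp m E (P v)) :=
    fun v => by simpa using ax v
  have ah' : ∀ v, Q (h v) = twistOp n H (Q v) ∧ (Q v = 0 → P (h v) = twistOp m H (P v)) :=
    fun v => by simpa using ah v
  have ay' : ∀ v, Q (y v) = twistOp n F (Q v) ∧ (Q v = 0 → P (y v) = twistOp m F (P v)) :=
    fun v => by simpa using ay v
  -- If the vector field of `x` is zero, then so are the other two, the action is nilpotent and
  -- `h`, a commutator, is zero.
  have hE0 : E ≠ 0 := by
    rintro rfl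
    have hH0 : H = 0 := by rw [bh]; simp
    have hF0 : F = 0 := by
      rw [hH0] at bY
      simpa using bY
    have hQx : ∀ v, Q (x v) = 0 := fun v => by rw [(ax' v).1]; simp [twistOp]
    have hQy : ∀ v, Q (y v) = 0 := fun v => by rw [(ay' v).1, hF0]; simp [twistOp]
    refine hh (LinearMap.ext fun v => hinj _ ?_ ?_)
    · rw [hxy, map_sub, (ax' _).2 (hQy v), (ay' _).2 (hQx v), hF0]
      simp [twistOp]
    · rw [hxy, map_sub, hQx, hQy, sub_zero]
  obtain ⟨α, β, γ, δ, hdet, rfl, rfl⟩ := exists_factorization hE hH hE0 (by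
    rw [C_ofNat] at bx
    exact bx.symm)
  have hαβ : α ≠ 0 ∨ β ≠ 0 := by
    by_contra! h0
    rw [h0.1, h0.2] at hdet
    norm_num at hdet
  -- Otherwise `x v` would be an eigenvector of weight `a + 2`.
  have hxv : x v = 0 := by
    by_contra h0
    have := hmax (a + 2) (x v) h0 (by
      have h1 := hhx v
      rw [hv, map_smul] at h1
      push_cast
      rw [add_smul, h1]
      abel)
    omega
  have hma : (m : ℤ) ≤ a := by
    obtain ⟨u, hu, hu'⟩ := hsurj ((C α + C β * X) ^ m) (by
      refine (natDegree_pow_le_of_le m (?_ : _ ≤ 1)).trans (by simp)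
      rw [add_comm]
      exact natDegree_linear_le)
    refine hmax m u ?_ ?_
    · rintro rfl
      rw [map_zero] at hu'
      exact pow_ne_zero m (linear_ne_zero hαβ) hu'.symm
    · refine sub_eq_zero.1 (hinj _ ?_ ?_)
      · rw [map_sub, map_smul, (ah' u).2 hu, hu', twistOp_linear_mul_linear hdet, smul_eq_C_mul]
        simp
      · rw [map_sub, map_smul, (ah' u).1, hu]
        simp [twistOp]
  have hQv : Q v = 0 := by
    obtain ⟨c, hc⟩ := eq_C_mul_linear_pow_of_twistOp_eq_zero (N := n) hαβ (hQ v)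
      (by rw [← (ax' v).1, hxv, map_zero])
    by_contra h0
    have h1 := (ah' v).1
    have h3 : twistOp n ((C α + C β * X) * (C γ + C δ * X)) (C c * (C α + C β * X) ^ n) =
        C c * (C (n : k) * (C α + C β * X) ^ n) := by
      rw [← twistOp_linear_mul_linear hdet]
      simp only [twistOp, derivative_mul, derivative_C]
      ring
    rw [hv, map_smul, hc, h3, smul_eq_C_mul, mul_left_comm (C c), ← hc] at h1
    have h4 : ((a : ℤ) : k) = ((n : ℤ) : k) := by
      simpa using C_injective (mul_right_cancel₀ h0 h1)
    have := Int.cast_injective h4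
    omega
  obtain ⟨c, hc⟩ := eq_C_mul_linear_pow_of_twistOp_eq_zero (N := m) hαβ (hP v hQv)
    (by rw [← (ax' v).2 hQv, hxv, map_zero])
  obtain ⟨N, rfl⟩ : ∃ N, m = N + 1 := ⟨m - 1, by omega⟩
  refine ⟨α, β, γ, δ, c, by rw [hdet]; simp, ?_, hQv, hc, ?_, ?_⟩
  · rintro rfl
    exact hv0 (hinj v (by rw [hc]; simp) hQv)
  · rw [(ay' v).1, hQv]
    simp [twistOp]
  · have h3 : twistOp (N + 1) F (C c * (C α + C β * X) ^ (N + 1)) =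
        C c * twistOp (N + 1) F ((C α + C β * X) ^ (N + 1)) := by
      simp only [twistOp, derivative_mul, derivative_C]
      ring
    rw [(ay' v).2 hQv, hc, h3, twistOp_linear_pow hαβ bh.symm, mul_comm _ c, C_mul,
      Nat.add_sub_cancel, mul_assoc]

end HighestWeight

/-! ### The rational map defined by two products of linear forms -/

section RationalMap

variable {k : Type*} [Field k] {m n : ℕ}

theorem isHomogeneous_linForm {ι : Type*} [Fintype ι] (v : ι → k) :
    (linForm v).IsHomogeneous 1 :=
  MvPolynomial.IsHomogeneous.sum _ _ _ fun i _ => by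
    simpa using (MvPolynomial.isHomogeneous_C _ (v i)).mul (MvPolynomial.isHomogeneous_X k i)

theorem eval_linForm {ι : Type*} [Fintype ι] (v x : ι → k) :
    MvPolynomial.eval x (linForm v) = v ⬝ᵥ x := by
  simp [linForm, dotProduct]

theorem exists_rep_eq [Infinite k] {g : (Idx m n → k) ≃ₗ[k] (Idx m n → k)}
    {p : ℙ k (Idx m n → k)} {A : Set (ℙ k (Idx m n → k))} (hp : p ∈ g • A) :
    ∃ (x : Idx m n → k) (hx : x ≠ 0), p.rep = g x ∧ Projectivization.mk k x hx ∈ A := by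
  have hx : g.symm p.rep ≠ 0 := (map_ne_zero_iff _ g.symm.injective).2 p.rep_nonzero
  refine ⟨g.symm p.rep, hx, (g.apply_symm_apply _).symm, ?_⟩
  rw [← mem_smul_iff_mk (g := g)]
  simpa using hp

theorem mem_smul_iff_of_rep_eq {g : (Idx m n → k) ≃ₗ[k] (Idx m n → k)}
    {p : ℙ k (Idx m n → k)} {A : Set (ℙ k (Idx m n → k))} {x : Idx m n → k} (hx : x ≠ 0)
    (h : p.rep = g x) : p ∈ g • A ↔ Projectivization.mk k x hx ∈ A := by
  rw [← mem_smul_iff_mk (g := g), ← p.mk_rep]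
  simp only [h]

/-- The pullback of a form along `(a, b, l, u) ↦ g (rulingPoint m n a b l u)`. -/
def pullForm (g : (Idx m n → k) ≃ₗ[k] (Idx m n → k)) :
    MvPolynomial (Idx m n) k →ₐ[k] MvPolynomial (Fin 4) k :=
  MvPolynomial.aeval fun i => ∑ j, MvPolynomial.C
    (LinearMap.toMatrix' (g : (Idx m n → k) →ₗ[k] (Idx m n → k)) i j) * rulingPoly k m n j

theorem eval_pullForm (g : (Idx m n → k) ≃ₗ[k] (Idx m n → k)) (F : MvPolynomial (Idx m n) k)
    (z : Fin 4 → k) : MvPolynomial.eval z (pullForm g F) =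
      MvPolynomial.eval (g (rulingPoint m n (z 0) (z 1) (z 2) (z 3))) F := by
  have : ((MvPolynomial.aeval z).comp (pullForm g) : MvPolynomial (Idx m n) k →ₐ[k] k) =
      MvPolynomial.aeval (g (rulingPoint m n (z 0) (z 1) (z 2) (z 3))) := by
    ext i
    have h1 : g (rulingPoint m n (z 0) (z 1) (z 2) (z 3)) =
        LinearMap.toMatrix' (g : (Idx m n → k) →ₗ[k] (Idx m n → k)) *ᵥ
          rulingPoint m n (z 0) (z 1) (z 2) (z 3) := (LinearMap.toMatrix'_mulVec _ _).symm
    have h3 : ∀ j, MvPolynomial.eval z (rulingPoly k m n j) =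
        rulingPoint m n (z 0) (z 1) (z 2) (z 3) j := by
      intro j
      have := eval_aeval_rulingPoly (MvPolynomial.X j) z
      simpa using this
    rw [h1]
    simp only [pullForm, AlgHom.comp_apply, MvPolynomial.aeval_X, map_sum, map_mul,
      MvPolynomial.aeval_C, Algebra.algebraMap_self, RingHom.id_apply, Matrix.mulVec, dotProduct]
    exact Finset.sum_congr rfl fun j _ => congrArg _ (h3 j)
  exact congrArg (fun f => f F) this

/-- The linear forms `v` and `w` on `g (scroll)` restrict on the scroll to multiples of
`ℓᵐ` and `ℓᵐ⁻¹ ℓ'`, where `ℓ = α a + β b` and `ℓ' = γ a + δ b` are independent linear forms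
on the projective line which is the base of the ruling. -/
structure IsPowerPair (g : (Idx m n → k) ≃ₗ[k] (Idx m n → k)) (v w : Idx m n → k)
    (α β γ δ c κ : k) : Prop where
  det_ne_zero : α * δ - β * γ ≠ 0
  c_ne_zero : c ≠ 0
  κ_ne_zero : κ ≠ 0
  eval_left : ∀ a b l u, MvPolynomial.eval (g (rulingPoint m n a b l u)) (linForm v) =
    l * (c * (α * a + β * b) ^ m)
  eval_right : ∀ a b l u, MvPolynomial.eval (g (rulingPoint m n a b l u)) (linForm w) =
    l * (κ * ((α * a + β * b) ^ (m - 1) * (γ * a + δ * b)))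

/-- A linear form is determined on the scroll by the polynomials of its two blocks. -/
theorem eval_linForm_rulingPoint {g : (Idx m n → k) ≃ₗ[k] (Idx m n → k)} {v : Idx m n → k}
    {G : Matrix (Idx m n) (Idx m n) k}
    (hG : G = LinearMap.toMatrix' (g : (Idx m n → k) →ₗ[k] (Idx m n → k)))
    (hQ : rightPoly (v ᵥ* G) = 0) {a l : k} (ha : a ≠ 0) (hl : l ≠ 0) (b u : k) :
    MvPolynomial.eval (g (rulingPoint m n a b l u)) (linForm v) =
      l * (a ^ m * (leftPoly (v ᵥ* G)).eval (b / a)) := by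
  have h1 : g (rulingPoint m n a b l u) = G *ᵥ rulingPoint m n a b l u := by
    rw [hG]
    exact (LinearMap.toMatrix'_mulVec _ _).symm
  rw [eval_linForm, h1, Matrix.dotProduct_mulVec, rulingPoint_eq_smul_scrollVec ha hl,
    dotProduct_smul, dotProduct_scrollVec, hQ, smul_eq_mul]
  simp [mul_assoc]

theorem X_zero_mul_X_two_ne_zero : (.X 0 * .X 2 : MvPolynomial (Fin 4) k) ≠ 0 :=
  mul_ne_zero (MvPolynomial.X_ne_zero _) (MvPolynomial.X_ne_zero _)

theorem IsPowerPair.of_polynomials [Infinite k] {g : (Idx m n → k) ≃ₗ[k] (Idx m n → k)}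
    {v w : Idx m n → k} {G : Matrix (Idx m n) (Idx m n) k}
    (hG : G = LinearMap.toMatrix' (g : (Idx m n → k) →ₗ[k] (Idx m n → k)))
    (hm : 1 ≤ m) {α β γ δ c κ : k} (hdet : α * δ - β * γ ≠ 0) (hc : c ≠ 0) (hκ : κ ≠ 0)
    (hQv : rightPoly (v ᵥ* G) = 0)
    (hPv : leftPoly (v ᵥ* G) = .C c * (.C α + .C β * .X) ^ m)
    (hQw : rightPoly (w ᵥ* G) = 0)
    (hPw : leftPoly (w ᵥ* G) = .C κ * ((.C α + .C β * .X) ^ (m - 1) * (.C γ + .C δ * .X))) :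
    IsPowerPair g v w α β γ δ c κ := by
  have lin : ∀ a b x y : k, a ≠ 0 → x * a + y * b = a * (x + y * (b / a)) := by
    intro a b x y ha
    field_simp
  refine ⟨hdet, hc, hκ, fun a b l u => ?_, fun a b l u => ?_⟩
  · have h0 : pullForm g (linForm v) - .X 2 * (.C c * (.C α * .X 0 + .C β * .X 1) ^ m) = 0 := by
      refine eq_zero_of_eval_eq_zero_of_eval_ne_zero X_zero_mul_X_two_ne_zero fun z hz => ?_
      simp only [map_mul, MvPolynomial.eval_X] at hz
      have ha := left_ne_zero_of_mul hz
      rw [map_sub, eval_pullForm, eval_linForm_rulingPoint hG hQv ha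
        (right_ne_zero_of_mul hz), hPv]
      simp [lin _ _ _ _ ha, mul_pow]
      ring
    have := congrArg (MvPolynomial.eval ![a, b, l, u]) h0
    rw [map_sub, eval_pullForm] at this
    simpa [sub_eq_zero] using this
  · have h0 : pullForm g (linForm w) - .X 2 * (.C κ * ((.C α * .X 0 + .C β * .X 1) ^ (m - 1) *
        (.C γ * .X 0 + .C δ * .X 1))) = 0 := by
      refine eq_zero_of_eval_eq_zero_of_eval_ne_zero X_zero_mul_X_two_ne_zero fun z hz => ?_
      simp only [map_mul, MvPolynomial.eval_X] at hz
      have ha := left_ne_zero_of_mul hz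
      rw [map_sub, eval_pullForm, eval_linForm_rulingPoint hG hQw ha
        (right_ne_zero_of_mul hz), hPw]
      obtain ⟨N, rfl⟩ : ∃ N, m = N + 1 := ⟨m - 1, by omega⟩
      simp [lin _ _ _ _ ha, mul_pow]
      ring
    have := congrArg (MvPolynomial.eval ![a, b, l, u]) h0
    rw [map_sub, eval_pullForm] at this
    simpa [sub_eq_zero] using this

variable {g : (Idx m n → k) ≃ₗ[k] (Idx m n → k)} {v w : Idx m n → k} {α β γ δ c κ : k}

theorem IsPowerPair.value_ne_zero (h : IsPowerPair g v w α β γ δ c κ) {a b : k}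
    (hab : a ≠ 0 ∨ b ≠ 0) :
    (![κ * (γ * a + δ * b), c * (α * a + β * b)] : Fin 2 → k) ≠ 0 := by
  intro h0
  have e1 : γ * a + δ * b = 0 := by
    have := congrFun h0 0
    simpa [h.κ_ne_zero] using this
  have e2 : α * a + β * b = 0 := by
    have := congrFun h0 1
    simpa [h.c_ne_zero] using this
  have ha : (α * δ - β * γ) * a = 0 := by linear_combination δ * e2 - β * e1
  have hb : (α * δ - β * γ) * b = 0 := by linear_combination α * e1 - γ * e2
  simp only [mul_eq_zero, h.det_ne_zero, false_or] at ha hb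
  simp [ha, hb] at hab

/-- The value at `(a : b)` of the isomorphism of the projective line which the rational map
induces on the base of the ruling. -/
def IsPowerPair.value (h : IsPowerPair g v w α β γ δ c κ) {a b : k} (hab : a ≠ 0 ∨ b ≠ 0) :
    ℙ k (Fin 2 → k) :=
  Projectivization.mk k _ (h.value_ne_zero hab)

theorem IsPowerPair.exists_value_eq (h : IsPowerPair g v w α β γ δ c κ) (q : ℙ k (Fin 2 → k)) :
    ∃ (a b : k) (hab : a ≠ 0 ∨ b ≠ 0), h.value hab = q := by
  have hd := h.det_ne_zero
  have hc := h.c_ne_zero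
  have hκ := h.κ_ne_zero
  set A := q.rep 0 / κ with hA
  set B := q.rep 1 / c with hB
  set a := (δ * B - β * A) / (α * δ - β * γ) with ha
  set b := (α * A - γ * B) / (α * δ - β * γ) with hb
  have had : (α * δ - β * γ) * a = δ * B - β * A := mul_div_cancel₀ _ hd
  have hbd : (α * δ - β * γ) * b = α * A - γ * B := mul_div_cancel₀ _ hd
  have e1 : κ * (γ * a + δ * b) = q.rep 0 := by
    have : γ * a + δ * b = A := by
      refine mul_left_cancel₀ hd ?_
      linear_combination γ * had + δ * hbd
    rw [this, hA]
    field_simp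
  have e2 : c * (α * a + β * b) = q.rep 1 := by
    have : α * a + β * b = B := by
      refine mul_left_cancel₀ hd ?_
      linear_combination α * had + β * hbd
    rw [this, hB]
    field_simp
  have hq : (![κ * (γ * a + δ * b), c * (α * a + β * b)] : Fin 2 → k) = q.rep := by
    funext i
    fin_cases i
    exacts [e1, e2]
  have hab : a ≠ 0 ∨ b ≠ 0 := by
    by_contra! h0
    refine q.rep_nonzero ?_
    rw [← hq, h0.1, h0.2]
    funext i
    fin_cases i <;> simp
  refine ⟨a, b, hab, ?_⟩
  rw [IsPowerPair.value]
  simp only [hq]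
  exact q.mk_rep

theorem IsPowerPair.exists_eq_mul_of_value_eq (h : IsPowerPair g v w α β γ δ c κ) {a b a' b' : k}
    {hab : a ≠ 0 ∨ b ≠ 0} {hab' : a' ≠ 0 ∨ b' ≠ 0} (he : h.value hab' = h.value hab) :
    ∃ r, a' = r * a ∧ b' = r * b := by
  have hd := h.det_ne_zero
  obtain ⟨r, hr⟩ := (Projectivization.mk_eq_mk_iff' k _ _ _ _).1 he
  refine ⟨r, ?_⟩
  have e1 : r * (γ * a + δ * b) = γ * a' + δ * b' := by
    have := congrFun hr 0
    simp only [Pi.smul_apply, Matrix.cons_val_zero, smul_eq_mul] at this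
    refine mul_left_cancel₀ h.κ_ne_zero ?_
    linear_combination this
  have e2 : r * (α * a + β * b) = α * a' + β * b' := by
    have := congrFun hr 1
    simp only [Pi.smul_apply, Matrix.cons_val, smul_eq_mul] at this
    refine mul_left_cancel₀ h.c_ne_zero ?_
    linear_combination this
  constructor
  · refine mul_left_cancel₀ hd ?_
    linear_combination β * e1 - δ * e2
  · refine mul_left_cancel₀ hd ?_
    linear_combination γ * e2 - α * e1

theorem rulingPoint_mul (r a b l u : k) :
    rulingPoint m n (r * a) (r * b) l u = rulingPoint m n a b (r ^ m * l) (r ^ n * u) := by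
  have hp : ∀ N i : ℕ, i ≤ N → (r * a) ^ (N - i) * (r * b) ^ i = r ^ N * (a ^ (N - i) * b ^ i) := by
    intro N i hi
    conv_rhs => rw [← Nat.sub_add_cancel hi, pow_add, Nat.sub_add_cancel hi]
    ring
  funext i
  rcases i with i | j
  · simp only [rulingPoint, Sum.elim_inl, hp m i (Nat.lt_succ_iff.1 i.2)]
    ring
  · simp only [rulingPoint, Sum.elim_inr, hp n j (Nat.lt_succ_iff.1 j.2)]
    ring

theorem mem_smul_scroll_of_rep_eq [Infinite k] {a b l u : k} {p : ℙ k (Idx m n → k)}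
    (hab : a ≠ 0 ∨ b ≠ 0) (hp : p.rep = g (rulingPoint m n a b l u)) : p ∈ g • scroll k m n := by
  have hx : rulingPoint m n a b l u ≠ 0 := by
    intro h0
    refine p.rep_nonzero ?_
    rw [hp, h0, map_zero]
  rw [mem_smul_iff_of_rep_eq hx hp, mk_mem_scroll]
  exact ⟨a, b, l, u, hab, rfl⟩

theorem exists_rep_eq_rulingPoint [Infinite k] {p : ℙ k (Idx m n → k)} (hp : p ∈ g • scroll k m n) :
    ∃ a b l u, (a ≠ 0 ∨ b ≠ 0) ∧ p.rep = g (rulingPoint m n a b l u) := by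
  obtain ⟨x, hx, h1, hm⟩ := exists_rep_eq hp
  obtain ⟨a, b, l, u, hab, rfl⟩ := (mk_mem_scroll hx).1 hm
  exact ⟨a, b, l, u, hab, h1⟩

/-- Every representation `F' / G'` of the rational map has, wherever it is defined, the value
prescribed by the point of the base: `F' ℓ` and `G' ℓ'` are proportional on a dense set, hence
everywhere. -/
theorem IsPowerPair.eq_value_of_ratMapsTo [Infinite k] (h : IsPowerPair g v w α β γ δ c κ)
    (hm : 1 ≤ m) {p : ℙ k (Idx m n → k)} {q : ℙ k (Fin 2 → k)} {a b l u : k} (hab : a ≠ 0 ∨ b ≠ 0)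
    (hp : p.rep = g (rulingPoint m n a b l u))
    (hq : RatMapsTo (g • scroll k m n) (linForm w) (linForm v) p q) : q = h.value hab := by
  obtain ⟨d, F, G, hF, hG, hvan, hne, rfl⟩ := hq
  have hhom : (F * linForm v - G * linForm w).IsHomogeneous (d + 1) :=
    (hF.mul (isHomogeneous_linForm v)).sub (hG.mul (isHomogeneous_linForm w))
  have hz : pullForm g F * (.C c * (.C α * .X 0 + .C β * .X 1)) -
      pullForm g G * (.C κ * (.C γ * .X 0 + .C δ * .X 1)) = 0 := by
    have hlin : (.C α * .X 0 + .C β * .X 1 : MvPolynomial (Fin 4) k) ≠ 0 := by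
      intro h0
      have e0 := congrArg (MvPolynomial.eval ![1, 0, 0, 0]) h0
      have e1 := congrArg (MvPolynomial.eval ![0, 1, 0, 0]) h0
      simp at e0 e1
      exact h.det_ne_zero (by rw [e0, e1]; ring)
    refine eq_zero_of_eval_eq_zero_of_eval_ne_zero
      (mul_ne_zero hlin X_zero_mul_X_two_ne_zero) fun z hz => ?_
    simp only [map_mul, map_add, MvPolynomial.eval_X, MvPolynomial.eval_C] at hz
    have hl := left_ne_zero_of_mul hz
    have h0 := left_ne_zero_of_mul (right_ne_zero_of_mul hz)
    have h2 := right_ne_zero_of_mul (right_ne_zero_of_mul hz)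
    obtain ⟨i, hi⟩ := exists_rulingPoint_inl_ne_zero (m := m) (n := n) (b := z 1)
      (Or.inl h0) h2 (z 3)
    have hx : rulingPoint m n (z 0) (z 1) (z 2) (z 3) ≠ 0 := fun h' => hi (by rw [h']; rfl)
    have hgx : g (rulingPoint m n (z 0) (z 1) (z 2) (z 3)) ≠ 0 :=
      (map_ne_zero_iff g g.injective).2 hx
    have hv := hvan (Projectivization.mk k _ hgx) ((mem_smul_iff_mk hx).2
      ((mk_mem_scroll hx).2 ⟨_, _, _, _, Or.inl h0, rfl⟩))
    rw [formVanishesAt_mk hhom, map_sub, map_mul, map_mul, h.eval_left, h.eval_right] at hv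
    obtain ⟨N, rfl⟩ : ∃ N, m = N + 1 := ⟨m - 1, by omega⟩
    simp only [map_sub, map_mul, map_add, MvPolynomial.eval_X, MvPolynomial.eval_C, eval_pullForm]
    refine mul_left_cancel₀ (mul_ne_zero h2 (pow_ne_zero N hl)) ?_
    rw [mul_zero, ← hv, Nat.add_sub_cancel, pow_succ]
    ring
  have key := congrArg (MvPolynomial.eval ![a, b, l, u]) hz
  simp only [map_sub, map_mul, map_add, MvPolynomial.eval_X, MvPolynomial.eval_C, eval_pullForm,
    map_zero] at key
  simp only [Matrix.cons_val] at key
  rw [← hp] at key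
  refine (Projectivization.mk_eq_mk_iff' k _ _ _ _).2 ?_
  have hvne := h.value_ne_zero hab
  have hc := h.c_ne_zero
  have hκ := h.κ_ne_zero
  by_cases hl : α * a + β * b = 0
  · have hl' : γ * a + δ * b ≠ 0 := by
      intro h'
      refine hvne (funext fun i => ?_)
      fin_cases i <;> simp [hl, h']
    have hG0 : MvPolynomial.eval p.rep G = 0 := by
      rw [hl] at key
      simpa [hκ, hl'] using key
    refine ⟨MvPolynomial.eval p.rep F / (κ * (γ * a + δ * b)), funext fun i => ?_⟩
    fin_cases i
    · simp
      field_simp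
    · simp [hl, hG0]
  · refine ⟨MvPolynomial.eval p.rep G / (c * (α * a + β * b)), funext fun i => ?_⟩
    fin_cases i
    · simp
      field_simp
      linear_combination -key
    · simp
      field_simp

/-- Away from the vertex, the forms `ℓ` and `ℓ'` times a common monomial which does not vanish at
the given point represent the rational map. -/
theorem IsPowerPair.ratMapsTo_value [Infinite k] (h : IsPowerPair g v w α β γ δ c κ)
    (hm : 1 ≤ m) {p : ℙ k (Idx m n → k)} {a b l u : k} (hab : a ≠ 0 ∨ b ≠ 0)
    (hp : p.rep = g (rulingPoint m n a b l u)) (hvert : p ∉ g • coneVertex k m n) :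
    RatMapsTo (g • scroll k m n) (linForm w) (linForm v) p (h.value hab) := by
  set G' := LinearMap.toMatrix' (g.symm : (Idx m n → k) →ₗ[k] (Idx m n → k)) with hG'
  have heval : ∀ f x, MvPolynomial.eval (g x) (linForm (f ᵥ* G')) = f ⬝ᵥ x := by
    intro f x
    rw [eval_linForm, ← Matrix.dotProduct_mulVec, hG',
      show LinearMap.toMatrix' (g.symm : (Idx m n → k) →ₗ[k] (Idx m n → k)) *ᵥ g x = x from
        (LinearMap.toMatrix'_mulVec _ _).trans (by simp)]
  -- The common factor of the coordinates `loIdx j` and `hiIdx j` of `rulingPoint m n a b l u`.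
  let r : Fin m ⊕ Fin n → k → k → k → k → k := fun j a b l u =>
    Sum.elim (fun i : Fin m => l * (a ^ (m - 1 - (i : ℕ)) * b ^ (i : ℕ)))
      (fun i : Fin n => u * (a ^ (n - 1 - (i : ℕ)) * b ^ (i : ℕ))) j
  have hlo : ∀ j a b l u, rulingPoint m n a b l u (loIdx j) = a * r j a b l u := by
    rintro (j | j) a b l u
    · have : m - (j : ℕ) = m - 1 - (j : ℕ) + 1 := by have := j.2; omega
      simp only [rulingPoint, loIdx, Sum.map_inl, Sum.elim_inl, Fin.val_castSucc, r, this]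
      ring
    · have : n - (j : ℕ) = n - 1 - (j : ℕ) + 1 := by have := j.2; omega
      simp only [rulingPoint, loIdx, Sum.map_inr, Sum.elim_inr, Fin.val_castSucc, r, this]
      ring
  have hhi : ∀ j a b l u, rulingPoint m n a b l u (hiIdx j) = b * r j a b l u := by
    rintro (j | j) a b l u
    · have : m - ((j : ℕ) + 1) = m - 1 - (j : ℕ) := by omega
      simp only [rulingPoint, hiIdx, Sum.map_inl, Sum.elim_inl, Fin.val_succ, r, this]
      ring
    · have : n - ((j : ℕ) + 1) = n - 1 - (j : ℕ) := by omega
      simp only [rulingPoint, hiIdx, Sum.map_inr, Sum.elim_inr, Fin.val_succ, r, this]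
      ring
  have hx : rulingPoint m n a b l u ≠ 0 := by
    intro h0
    refine p.rep_nonzero ?_
    rw [hp, h0, map_zero]
  obtain ⟨j, hj⟩ : ∃ j, r j a b l u ≠ 0 := by
    by_contra! hr
    have hl0 : l = 0 := by
      by_contra hl
      rcases hab with ha | hb
      · simpa [r, ha, hl] using hr (.inl ⟨0, by omega⟩)
      · simpa [r, hb, hl] using hr (.inl ⟨m - 1, by omega⟩)
    rw [mem_smul_iff_of_rep_eq hx hp, mk_mem_coneVertex] at hvert
    have hn : n ≠ 0 := fun hn => hvert ⟨hn, by simp [rulingPoint, hl0]⟩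
    have hu0 : u = 0 := by
      by_contra hu
      rcases hab with ha | hb
      · simpa [r, ha, hu] using hr (.inr ⟨0, by omega⟩)
      · simpa [r, hb, hu] using hr (.inr ⟨n - 1, by omega⟩)
    refine hx (funext fun i => ?_)
    rcases i with i | i <;> simp [rulingPoint, hl0, hu0]
  let form : k → k → Idx m n → k := fun x y =>
    Pi.single (loIdx j) x + Pi.single (hiIdx j) y
  have hform : ∀ x y a b l u, form x y ⬝ᵥ rulingPoint m n a b l u =
      r j a b l u * (x * a + y * b) := by
    intro x y a b l u
    rw [add_dotProduct, single_dotProduct, single_dotProduct, hlo, hhi]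
    ring
  have hF : MvPolynomial.eval p.rep (linForm (form (κ * γ) (κ * δ) ᵥ* G')) =
      r j a b l u * (κ * (γ * a + δ * b)) := by
    rw [hp, heval, hform]
    ring
  have hG : MvPolynomial.eval p.rep (linForm (form (c * α) (c * β) ᵥ* G')) =
      r j a b l u * (c * (α * a + β * b)) := by
    rw [hp, heval, hform]
    ring
  have hsmul : (![MvPolynomial.eval p.rep (linForm (form (κ * γ) (κ * δ) ᵥ* G')),
      MvPolynomial.eval p.rep (linForm (form (c * α) (c * β) ᵥ* G'))] : Fin 2 → k) =
      r j a b l u • ![κ * (γ * a + δ * b), c * (α * a + β * b)] := by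
    rw [hF, hG]
    simp
  refine ⟨1, linForm (form (κ * γ) (κ * δ) ᵥ* G'), linForm (form (c * α) (c * β) ᵥ* G'),
    isHomogeneous_linForm _, isHomogeneous_linForm _, fun x hxX => ?_, ?_, ?_⟩
  · obtain ⟨a', b', l', u', -, hx'⟩ := exists_rep_eq_rulingPoint hxX
    rw [FormVanishesAt, hx', map_sub, map_mul, map_mul, heval, heval, hform, hform,
      h.eval_left, h.eval_right]
    obtain ⟨N, rfl⟩ : ∃ N, m = N + 1 := ⟨m - 1, by omega⟩
    rw [Nat.add_sub_cancel, pow_succ]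
    ring
  · rw [hsmul]
    exact smul_ne_zero hj (h.value_ne_zero hab)
  · refine (Projectivization.mk_eq_mk_iff' k _ _ _ _).2 ⟨(r j a b l u)⁻¹, ?_⟩
    rw [hsmul, inv_smul_smul₀ hj]

/-- At the vertex, which lies on all lines of the ruling, the values prescribed by the different
points of the base contradict one another. -/
theorem IsPowerPair.not_ratMapsTo_of_mem_coneVertex [Infinite k]
    (h : IsPowerPair g v w α β γ δ c κ) (hm : 1 ≤ m) {p : ℙ k (Idx m n → k)}
    {q : ℙ k (Fin 2 → k)} (hp : p ∈ g • scroll k m n) (hvert : p ∈ g • coneVertex k m n) :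
    ¬ RatMapsTo (g • scroll k m n) (linForm w) (linForm v) p q := by
  intro hq
  obtain ⟨a, b, l, u, hab, hrep⟩ := exists_rep_eq_rulingPoint hp
  have hx : rulingPoint m n a b l u ≠ 0 := by
    intro h0
    refine p.rep_nonzero ?_
    rw [hrep, h0, map_zero]
  rw [mem_smul_iff_of_rep_eq hx hrep, mk_mem_coneVertex] at hvert
  obtain ⟨rfl, hvert⟩ := hvert
  obtain rfl : l = 0 := by
    by_contra hl
    obtain ⟨i, hi⟩ := exists_rulingPoint_inl_ne_zero (m := m) (n := 0) hab hl u
    exact hi (hvert i)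
  have hrep' : ∀ a' b', p.rep = g (rulingPoint m 0 a' b' 0 u) := by
    intro a' b'
    rw [hrep]
    congr 1
    funext i
    rcases i with i | i <;> simp [rulingPoint]
  have h1 := h.eq_value_of_ratMapsTo hm (a := 1) (b := 0) (by simp) (hrep' _ _) hq
  have h2 := h.eq_value_of_ratMapsTo hm (a := 0) (b := 1) (by simp) (hrep' _ _) hq
  obtain ⟨r, hr, hr'⟩ := h.exists_eq_mul_of_value_eq (h1.symm.trans h2)
  simp at hr

theorem IsPowerPair.ratFibre_value [Infinite k] (h : IsPowerPair g v w α β γ δ c κ)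
    (hm : 1 ≤ m) {a b : k} (hab : a ≠ 0 ∨ b ≠ 0) :
    ratFibre (g • scroll k m n) (linForm w) (linForm v) (h.value hab) =
      (g • rulingLine k m n a b) \ (g • coneVertex k m n) := by
  ext p
  constructor
  · rintro ⟨hp, hq⟩
    refine ⟨?_, fun hvert => h.not_ratMapsTo_of_mem_coneVertex hm hp hvert hq⟩
    obtain ⟨a', b', l, u, hab', hrep⟩ := exists_rep_eq_rulingPoint hp
    obtain ⟨r, rfl, rfl⟩ := h.exists_eq_mul_of_value_eq
      (h.eq_value_of_ratMapsTo hm hab' hrep hq).symm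
    have hx : rulingPoint m n (r * a) (r * b) l u ≠ 0 := by
      intro h0
      refine p.rep_nonzero ?_
      rw [hrep, h0, map_zero]
    rw [mem_smul_iff_of_rep_eq hx hrep, mk_mem_rulingLine]
    exact ⟨_, _, rulingPoint_mul r a b l u⟩
  · rintro ⟨hp, hvert⟩
    obtain ⟨x, hx, hrep, hmem⟩ := exists_rep_eq hp
    obtain ⟨l, u, rfl⟩ := (mk_mem_rulingLine hx).1 hmem
    exact ⟨mem_smul_scroll_of_rep_eq hab hrep, h.ratMapsTo_value hm hab hrep hvert⟩

end RationalMap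

/-! ### The representation on linear forms -/

section LieRepresentation

open Polynomial

variable {k : Type*} [Field k] {m n : ℕ}

/-- The Chevalley basis element `x`. -/
def sl2X (k : Type*) [Field k] : sl2 k :=
  ⟨!![0, 1; 0, 0], LinearMap.mem_ker.2 (by simp [Matrix.trace_fin_two])⟩

theorem lie_sl2X_sl2Y : ⁅sl2X k, sl2Y k⁆ = sl2H k := by
  refine Subtype.ext ?_
  rw [LieSubalgebra.coe_bracket, Ring.lie_def]
  ext i j
  fin_cases i <;> fin_cases j <;> simp [sl2X, sl2Y, sl2H]

theorem lie_sl2H_sl2X : ⁅sl2H k, sl2X k⁆ = (2 : k) • sl2X k := by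
  refine Subtype.ext ?_
  rw [LieSubalgebra.coe_bracket, Ring.lie_def]
  ext i j
  fin_cases i <;> fin_cases j <;> simp [sl2X, sl2H]
  norm_num

theorem lie_sl2H_sl2Y : ⁅sl2H k, sl2Y k⁆ = (-2 : k) • sl2Y k := by
  refine Subtype.ext ?_
  rw [LieSubalgebra.coe_bracket, Ring.lie_def]
  ext i j
  fin_cases i <;> fin_cases j <;> simp [sl2Y, sl2H]
  norm_num

theorem sl2H_ne_zero : sl2H k ≠ 0 := by
  intro h
  have := congrFun (congrFun (congrArg Subtype.val h) 0) 0
  simp [sl2H] at this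

variable {ι : Type*} [Fintype ι] [DecidableEq ι] {X : Set (ℙ k (ι → k))}
  {S : LieSubalgebra k (lieAlg X)}

theorem Rep_mulVec (σ : sl2 k ≃ₗ⁅k⁆ S) (ξ : sl2 k) (v : ι → k) :
    Rep σ ξ *ᵥ v = -(v ᵥ* (((σ ξ : S) : lieAlg X) : Matrix ι ι k)) := by
  rw [← Matrix.mulVec_transpose, ← Matrix.neg_mulVec]
  rfl

theorem Rep_ne_zero (σ : sl2 k ≃ₗ⁅k⁆ S) {ξ : sl2 k} (hξ : ξ ≠ 0) : Rep σ ξ ≠ 0 := by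
  intro h
  refine hξ ?_
  have h1 : -(((σ ξ : S) : lieAlg X) : Matrix ι ι k)ᵀ = 0 := h
  have h2 : (((σ ξ : S) : lieAlg X) : Matrix ι ι k) = 0 := by simpa using h1
  have h3 : σ ξ = 0 := Subtype.ext (Subtype.ext h2)
  simpa using h3

theorem Rep_lie_mulVec (σ : sl2 k ≃ₗ⁅k⁆ S) (ξ η : sl2 k) (v : ι → k) :
    Rep σ ⁅ξ, η⁆ *ᵥ v = Rep σ ξ *ᵥ (Rep σ η *ᵥ v) - Rep σ η *ᵥ (Rep σ ξ *ᵥ v) := by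
  rw [LieHom.map_lie, Ring.lie_def, Matrix.sub_mulVec, Matrix.mulVec_mulVec, Matrix.mulVec_mulVec]

theorem exists_vecMul_eq_polynomials {G G' : Matrix (Idx m n) (Idx m n) k} (hG : G' * G = 1)
    {p q : k[X]} (hp : p.natDegree ≤ m) (hq : q.natDegree ≤ n) :
    ∃ v : Idx m n → k, leftPoly (v ᵥ* G) = p ∧ rightPoly (v ᵥ* G) = q := by
  have hsum : ∀ {N : ℕ} {f : k[X]}, f.natDegree ≤ N →
      ∑ i : Fin (N + 1), f.coeff i • (X : k[X]) ^ (i : ℕ) = f := fun {N f} hf => by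
    conv_rhs => rw [f.as_sum_range_C_mul_X_pow' (Nat.lt_succ_of_le hf), Finset.sum_range]
    simp only [smul_eq_C_mul]
  refine ⟨Sum.elim (fun i : Fin (m + 1) => p.coeff i) (fun j : Fin (n + 1) => q.coeff j) ᵥ* G', ?_⟩
  rw [Matrix.vecMul_vecMul, hG, Matrix.vecMul_one]
  exact ⟨hsum hp, hsum hq⟩

theorem eq_zero_of_polynomials_eq_zero {u : Idx m n → k} (hl : leftPoly u = 0)
    (hr : rightPoly u = 0) : u = 0 := by
  funext i
  rcases i with i | j
  · rw [← coeff_leftPoly u, hl]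
    simp
  · rw [← coeff_rightPoly u, hr]
    simp

/-- A highest weight vector `v` of the representation on linear forms restricts to the scroll as
`ℓᵐ`, and `y v` as `ℓᵐ⁻¹ ℓ'`. -/
theorem exists_isPowerPair [IsAlgClosed k] [CharZero k] (hmn : n < m) (h2 : 2 ≤ m)
    {g : (Idx m n → k) ≃ₗ[k] (Idx m n → k)} {S : LieSubalgebra k (lieAlg (g • scroll k m n))}
    (σ : sl2 k ≃ₗ⁅k⁆ S) {a : ℤ}
    (ha : ∀ b : ℤ, Module.End.HasEigenvalue (Matrix.toLin' (Rep σ (sl2H k))) (b : k) → b ≤ a)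
    {v : Idx m n → k}
    (hv : Module.End.HasEigenvector (Matrix.toLin' (Rep σ (sl2H k))) (a : k) v) :
    ∃ α β γ δ c κ : k, IsPowerPair g v (Rep σ (sl2Y k) *ᵥ v) α β γ δ c κ := by
  set G := LinearMap.toMatrix' (g : (Idx m n → k) →ₗ[k] (Idx m n → k)) with hG
  set G' := LinearMap.toMatrix' (g.symm : (Idx m n → k) →ₗ[k] (Idx m n → k)) with hG'
  have hGG' : G * G' = 1 := by
    rw [hG, hG', ← LinearMap.toMatrix'_comp]
    simp
  have hG'G : G' * G = 1 := by
    rw [hG, hG', ← LinearMap.toMatrix'_comp]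
    simp
  let P : (Idx m n → k) →ₗ[k] k[X] := leftPoly ∘ₗ G.vecMulLinear
  let Q : (Idx m n → k) →ₗ[k] k[X] := rightPoly ∘ₗ G.vecMulLinear
  have hPv : ∀ v, P v = leftPoly (v ᵥ* G) := fun _ => rfl
  have hQv : ∀ v, Q v = rightPoly (v ᵥ* G) := fun _ => rfl
  have hact : ∀ ξ : sl2 k, ∃ (d : k[X]) (c₁ c₂ : k), d.natDegree ≤ 2 ∧
      ActsBy m n P Q (Matrix.toLin' (Rep σ ξ)) d c₁ c₂ := by
    intro ξ
    obtain ⟨d, c₁, c₂, hd, h⟩ := exists_vectorField_of_mem_glLie (g := g) hmn h2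
      (M := (((σ ξ : S) : lieAlg (g • scroll k m n)) : Matrix _ _ k))
      (LieSubalgebra.mem_inf _ _ _ |>.1 (SetLike.coe_mem (σ ξ : S).1)).1
    refine ⟨d, c₁, c₂, hd, fun v => ?_⟩
    obtain ⟨h1, h3⟩ := h v
    rw [Matrix.toLin'_apply, Rep_mulVec, map_neg, map_neg, hPv, hPv, hQv, hQv]
    constructor
    · rw [h1]
      simp only [twistOp]
      ring
    · intro h0
      rw [h3 h0]
      simp only [twistOp]
      ring
  obtain ⟨E, cx₁, cx₂, hE, ax⟩ := hact (sl2X k)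
  obtain ⟨H, ch₁, ch₂, hH, ah⟩ := hact (sl2H k)
  obtain ⟨F, cy₁, cy₂, -, ay⟩ := hact (sl2Y k)
  have lie : ∀ ξ η v, Matrix.toLin' (Rep σ ⁅ξ, η⁆) v =
      Matrix.toLin' (Rep σ ξ) (Matrix.toLin' (Rep σ η) v) -
        Matrix.toLin' (Rep σ η) (Matrix.toLin' (Rep σ ξ) v) := by
    intro ξ η v
    simp only [Matrix.toLin'_apply]
    exact Rep_lie_mulVec σ ξ η v
  obtain ⟨α, β, γ, δ, c, hdet, hc, q1, q2, q3, q4⟩ := highestWeight_eq_pow hmn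
    (P := P) (Q := Q) (x := Matrix.toLin' (Rep σ (sl2X k))) (h := Matrix.toLin' (Rep σ (sl2H k)))
    (y := Matrix.toLin' (Rep σ (sl2Y k)))
    (fun v _ => natDegree_leftPoly_le _) (fun v => natDegree_rightPoly_le _)
    (fun v hp hq => by
      have h0 : v ᵥ* G = 0 := eq_zero_of_polynomials_eq_zero hp hq
      rw [← Matrix.vecMul_one v, ← hGG', ← Matrix.vecMul_vecMul, h0, Matrix.zero_vecMul])
    (fun f hf => by
      obtain ⟨v, h1, h2⟩ := exists_vecMul_eq_polynomials (m := m) (n := n) hG'G hf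
        (q := 0) (by simp)
      exact ⟨v, h2, h1⟩)
    (by
      obtain ⟨v, -, h2⟩ := exists_vecMul_eq_polynomials (m := m) (n := n) hG'G (p := 0)
        (q := 1) (by simp) (by simp)
      exact ⟨v, h2⟩)
    (fun v => by rw [← lie, lie_sl2X_sl2Y])
    (fun v => by rw [← lie, lie_sl2H_sl2X, map_smul, map_smul, LinearMap.smul_apply])
    (fun v => by rw [← lie, lie_sl2H_sl2Y, map_smul, map_smul, LinearMap.smul_apply])
    (fun h0 => Rep_ne_zero σ sl2H_ne_zero (Matrix.toLin'.map_eq_zero_iff.1 h0))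
    hE hH ax ah ay hv.2 hv.apply_eq_smul
    (fun b u hu hb => ha b (Module.End.hasEigenvalue_of_hasEigenvector
      (Module.End.hasEigenvector_iff.2 ⟨Module.End.mem_eigenspace_iff.2 hb, hu⟩)))
  have hm0 : (m : k) ≠ 0 := Nat.cast_ne_zero.2 (by omega)
  exact ⟨α, β, γ, δ, c, -(m / 2 : k) * c, .of_polynomials hG (by omega) hdet hc
    (mul_ne_zero (neg_ne_zero.2 (div_ne_zero hm0 two_ne_zero)) hc) q1 q2 q3 q4⟩

end LieRepresentation

end ScrollFib

end

theorem mainTheorem2 {k : Type*} [Field k] [IsAlgClosed k] [CharZero k] (m n : ℕ)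
    (hmn : n < m) (h2 : 2 ≤ m + n)
    (X : Set (ℙ k (ScrollFib.Idx m n → k)))
    (g : (ScrollFib.Idx m n → k) ≃ₗ[k] (ScrollFib.Idx m n → k))
    (hX : X = g • ScrollFib.scroll k m n)
    (S : LieSubalgebra k (ScrollFib.lieAlg X)) (hS : ScrollFib.IsLevi S)
    (σ : ScrollFib.sl2 k ≃ₗ⁅k⁆ S)
    (a : ℤ)
    (ha : IsGreatest {b : ℤ | Module.End.HasEigenvalue
      (Matrix.toLin' (ScrollFib.Rep σ (ScrollFib.sl2H k))) (b : k)} a)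
    (v w : ScrollFib.Idx m n → k)
    (hv : Module.End.HasEigenvector
      (Matrix.toLin' (ScrollFib.Rep σ (ScrollFib.sl2H k))) (a : k) v)
    (hw : w = ScrollFib.Rep σ (ScrollFib.sl2Y k) *ᵥ v) :
    (∃ p ∈ X, ¬ ScrollFib.FormVanishesAt (ScrollFib.linForm v) p) ∧
    (∀ p ∈ X, ∀ q q' : ℙ k (Fin 2 → k),
      ScrollFib.RatMapsTo X (ScrollFib.linForm w) (ScrollFib.linForm v) p q →
      ScrollFib.RatMapsTo X (ScrollFib.linForm w) (ScrollFib.linForm v) p q' → q = q') ∧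
    (∀ p ∈ X,
      (∃ q, ScrollFib.RatMapsTo X (ScrollFib.linForm w) (ScrollFib.linForm v) p q) ↔
        p ∉ g • ScrollFib.coneVertex k m n) ∧
    Set.range (ScrollFib.ratFibre X (ScrollFib.linForm w) (ScrollFib.linForm v)) =
      (fun L => (g • L) \ (g • ScrollFib.coneVertex k m n)) '' ScrollFib.ruling k m n := by
  subst hX hw
  obtain ⟨α, β, γ, δ, c, κ, h⟩ := ScrollFib.exists_isPowerPair hmn (by omega) σ ha.2 hv
  have hm : 1 ≤ m := by omega
  refine ⟨?_, ?_, fun p hp => ⟨?_, fun hvert => ?_⟩, ?_⟩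
  · -- A point of the base at which `ℓ` does not vanish.
    obtain ⟨a, b, hab, hl⟩ : ∃ a b : k, (a ≠ 0 ∨ b ≠ 0) ∧ α * a + β * b ≠ 0 := by
      by_cases hα : α = 0
      · exact ⟨0, 1, by simp, fun h0 => h.det_ne_zero (by
          rw [hα, show β = 0 by simpa using h0]; ring)⟩
      · exact ⟨1, 0, by simp, by simpa using hα⟩
    have hx : ScrollFib.rulingPoint m n a b 1 0 ≠ 0 := fun h0 => by
      obtain ⟨i, hi⟩ := ScrollFib.exists_rulingPoint_inl_ne_zero (m := m) (n := n) hab one_ne_zero 0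
      exact hi (congrFun h0 _)
    refine ⟨Projectivization.mk k _ ((map_ne_zero_iff g g.injective).2 hx),
      (ScrollFib.mem_smul_iff_mk hx).2
        ((ScrollFib.mk_mem_scroll hx).2 ⟨a, b, 1, 0, hab, rfl⟩), ?_⟩
    rw [ScrollFib.formVanishesAt_mk (ScrollFib.isHomogeneous_linForm v), h.eval_left, one_mul]
    exact mul_ne_zero h.c_ne_zero (pow_ne_zero _ hl)
  · intro p hp q q' hq hq'
    obtain ⟨a, b, l, u, hab, hrep⟩ := ScrollFib.exists_rep_eq_rulingPoint hp
    rw [h.eq_value_of_ratMapsTo hm hab hrep hq, h.eq_value_of_ratMapsTo hm hab hrep hq']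
  · rintro ⟨q, hq⟩ hvert
    exact h.not_ratMapsTo_of_mem_coneVertex hm hp hvert hq
  · obtain ⟨a, b, l, u, hab, hrep⟩ := ScrollFib.exists_rep_eq_rulingPoint hp
    exact ⟨_, h.ratMapsTo_value hm hab hrep hvert⟩
  · ext L
    constructor
    · rintro ⟨q, rfl⟩
      obtain ⟨a, b, hab, rfl⟩ := h.exists_value_eq q
      exact ⟨_, ⟨a, b, hab, rfl⟩, (h.ratFibre_value hm hab).symm⟩
    · rintro ⟨_, ⟨a, b, hab, rfl⟩, rfl⟩
      exact ⟨_, h.ratFibre_value hm hab⟩
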